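/- **A Markov renewal theorem.** Let $M\ge 2$, $\Sigma=\{1,\dots,M\}$, let $\mathcal A\subseteq\Sigma^2$ be a set of admissible two-letter words, and let $\tilde\eta,\tilde\xi:\mathcal A\to\mathbb R$. Let $\Sigma_A=\{x\in\Sigma^{\mathbb N}: x_kx_{k+1}\in\mathcal A\ \forall k\}$ with the product topology and left shift $\sigma$, put $\xi(x)=\tilde\xi(x_1x_2)$, and assume that there is an $n$ with $S_n\xi=\sum_{k=0}^{n-1}\xi\circ\sigma^k>0$ on $\Sigma_A$. Let $\tilde F_{ij}$ be the (distribution function of the) measure with mass $e^{\tilde\eta(ji)}$ at the point $\tilde\xi(ji)$ if $ji\in\mathcal A$, and $\tilde F_{ij}=0$ otherwise. Suppose that the matrix $F=(\|\tilde F_{ij}\|_\infty)_{i,j}$ is primitive. For $s\in\mathbb R$ let $B(s)$ be the matrix with entries $B_{ij}(s)=\int e^{sT}\tilde F_{ij}(dT)$. Let $\delta>0$ be such that $B(-\delta)$ has spectral radius $1$, and let $\nu,h$ be vectors with strictly positive entries such that $\nu B(-\delta)=\nu$ and $B(-\delta)h=h$. Let $f_1,\dots,f_M:\mathbb R\to\mathbb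 R$ be directly Riemann integrable (for all sufficiently small $r>0$ the sums $\sum_{k\in\mathbb Z}r\inf_{[(k-1)r,kr)}f_i$ and $\sum_{k\in\mathbb Z}r\sup_{[(k-1)r,kr)}f_i$ are finite and converge absolutely, and they tend to the same finite limit as $r\to0$). Suppose that there are $C,s>0$ with $e^{-\delta t}|f_i(t)|\le Ce^{st}$ for all $t<0$ and all $i$. Consider the Markov renewal equation $$N(t,i)=\sum_{j=1}^M\int_{-\infty}^\infty N(t-u,j)\,\tilde F_{ij}(du)+f_i(t)\qquad(t\in\mathbb R,\ i\in\Sigma).\tag{$*$}$$ Write $(Qg)(t,i)=\sum_j\int g(t-u,j)\,\tilde F_{ij}(du)$. Then: 0. $\int e^{-\delta T}|f_j(T)|\,dT<\infty$ for all $j$ and $\sum_{k,j}\nu_kh_j\int Te^{-\delta T}\tilde F_{kj}(dT)>0$, so that $$G(i):=\frac{h_i\sum_{j}\nu_j\int e^{-\delta T}f_j(T)\,dT}{\sum_{k,j}\nu_kh_j\int Te^{-\delta T}\tilde F_{kj}(dT)}$$ is well defined. The series $\sum_{n\ge0}(Q^n|f|)(t,i)$ converges for all $t,i$, and the renewal function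 $N=\sum_{n\ge0}Q^nf$ solves $(*)$ and satisfies $\lim_{t\to-\infty}e^{-\delta t}N(t,i)=0$ for all $i$. Moreover, every solution $N$ of $(*)$ such that $\lim_{t\to-\infty}e^{-\delta t}N(t,i)=0$ for all $i$ has the following properties. 1. If $\xi$ is non-lattice (that is, there are no continuous $\zeta,\psi:\Sigma_A\to\mathbb R$ with $\xi-\zeta=\psi-\psi\circ\sigma$ such that $\zeta$ takes its values in a discrete subgroup of $\mathbb R$), then $\lim_{t\to\infty}e^{-\delta t}N(t,i)=G(i)$ for every $i$. 2. In every case, $T\mapsto e^{-\delta T}N(T,i)$ is integrable on bounded intervals and $\lim_{t\to\infty}t^{-1}\int_0^te^{-\delta T}N(T,i)\,dT=G(i)$ for every $i$. -/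

import Mathlib

open Filter Topology MeasureTheory Set

noncomputable section

namespace MarkovRenewal

/-- `lowerStep f h k` is the infimum of `f` over `[(k - 1) h, k h)`. -/
def lowerStep (f : ℝ → ℝ) (h : ℝ) (k : ℤ) : ℝ :=
  sInf (f '' Ico (((k : ℝ) - 1) * h) ((k : ℝ) * h))

/-- `upperStep f h k` is the supremum of `f` over `[(k - 1) h, k h)`. -/
def upperStep (f : ℝ → ℝ) (h : ℝ) (k : ℤ) : ℝ :=
  sSup (f '' Ico (((k : ℝ) - 1) * h) ((k : ℝ) * h))

/-- Direct Riemann integrability on `ℝ`: for all sufficiently small mesh sizes `h > 0` the infima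
and suprema over the mesh intervals are finite and the lower and upper Riemann sums over the whole
line converge (absolutely), and as `h → 0` both tend to the same finite limit. -/
def DirectlyRiemannIntegrable (f : ℝ → ℝ) : Prop :=
  (∀ᶠ h in 𝓝[>] (0 : ℝ),
    (∀ k : ℤ, BddBelow (f '' Ico (((k : ℝ) - 1) * h) ((k : ℝ) * h)) ∧
      BddAbove (f '' Ico (((k : ℝ) - 1) * h) ((k : ℝ) * h))) ∧
    (Summable fun k : ℤ => h * lowerStep f h k) ∧
    (Summable fun k : ℤ => h * upperStep f h k)) ∧
  ∃ L : ℝ,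
    Tendsto (fun h : ℝ => ∑' k : ℤ, h * lowerStep f h k) (𝓝[>] 0) (𝓝 L) ∧
    Tendsto (fun h : ℝ => ∑' k : ℤ, h * upperStep f h k) (𝓝[>] 0) (𝓝 L)

/-- The one-sided subshift `Σ_A` of finite type over the alphabet `Fin M`; `A k l` says that the
two-letter word `kl` is admissible. It carries the subspace topology of the product topology. -/
abbrev Subshift {M : ℕ} (A : Fin M → Fin M → Prop) : Type :=
  {x : ℕ → Fin M // ∀ k, A (x k) (x (k + 1))}

/-- The left shift on `Σ_A`. -/
def shift {M : ℕ} {A : Fin M → Fin M → Prop} (x : Subshift A) : Subshift A :=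
  ⟨fun k => x.1 (k + 1), fun k => x.2 (k + 1)⟩

/-- The function on `Σ_A` that is constant on cylinders of length two and is given there by the
values `ξ k l` on the admissible words `kl`. -/
def pairFun {M : ℕ} (A : Fin M → Fin M → Prop) (ξ : Fin M → Fin M → ℝ) : Subshift A → ℝ :=
  fun x => ξ (x.1 0) (x.1 1)

/-- A function on `Σ_A` is lattice if it is co-homologous (through a continuous transfer function)
to a continuous function with range in a discrete subgroup of `ℝ`. -/
def IsLattice {M : ℕ} {A : Fin M → Fin M → Prop} (φ : Subshift A → ℝ) : Prop :=
  ∃ ζ ψ : Subshift A → ℝ, Continuous ζ ∧ Continuous ψ ∧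
    (∀ x, φ x - ζ x = ψ x - ψ (shift x)) ∧
    ∃ G : AddSubgroup ℝ, DiscreteTopology G ∧ ∀ x, ζ x ∈ G

open Classical in
/-- The measure `F̃_ij(du)`: mass `exp (η j i)` at the point `ξ j i` if the word `ji` is admissible,
and zero otherwise. -/
def kernel {M : ℕ} (A : Fin M → Fin M → Prop) (η ξ : Fin M → Fin M → ℝ) (i j : Fin M) :
    Measure ℝ :=
  if A j i then ENNReal.ofReal (Real.exp (η j i)) • Measure.dirac (ξ j i) else 0

/-- The distribution function `F̃_ij(t)`. -/
def distFun {M : ℕ} (A : Fin M → Fin M → Prop) (η ξ : Fin M → Fin M → ℝ) (i j : Fin M) (t : ℝ) :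
    ℝ :=
  (kernel A η ξ i j).real (Iic t)

/-- The matrix of the masses `‖F̃_ij‖_∞`. -/
def massMatrix {M : ℕ} (A : Fin M → Fin M → Prop) (η ξ : Fin M → Fin M → ℝ) :
    Matrix (Fin M) (Fin M) ℝ :=
  Matrix.of fun i j => ⨆ t : ℝ, |distFun A η ξ i j t|

/-- The matrix `B(s)` with entries `∫ exp(s T) F̃_ij(dT)`. -/
def transformMatrix {M : ℕ} (A : Fin M → Fin M → Prop) (η ξ : Fin M → Fin M → ℝ) (s : ℝ) :
    Matrix (Fin M) (Fin M) ℝ :=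
  Matrix.of fun i j => ∫ T, Real.exp (s * T) ∂(kernel A η ξ i j)

/-- The convolution operator `(g_j)_j ↦ (∑_j ∫ g_j(· - u) F̃_ij(du))_i`. -/
def renewalOp {M : ℕ} (A : Fin M → Fin M → Prop) (η ξ : Fin M → Fin M → ℝ)
    (g : Fin M → ℝ → ℝ) : Fin M → ℝ → ℝ :=
  fun i t => ∑ j, ∫ u, g j (t - u) ∂(kernel A η ξ i j)

/-- `N` (with `N i t` for `N(t, i)`) solves the Markov renewal equation with inhomogeneity `f`. -/
def SolvesRenewalEq {M : ℕ} (A : Fin M → Fin M → Prop) (η ξ : Fin M → Fin M → ℝ)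
    (f N : Fin M → ℝ → ℝ) : Prop :=
  ∀ i t, N i t = (∑ j, ∫ u, N j (t - u) ∂(kernel A η ξ i j)) + f i t

/-- The renewal function: the sum over `n` of the `n`-fold convolutions of the kernel with `f`. -/
def renewalFunction {M : ℕ} (A : Fin M → Fin M → Prop) (η ξ : Fin M → Fin M → ℝ)
    (f : Fin M → ℝ → ℝ) : Fin M → ℝ → ℝ :=
  fun i t => ∑' n : ℕ, ((renewalOp A η ξ)^[n] f) i t

/-- The denominator `∑_{k,j} ν_k h_j ∫ T exp(-δ T) F̃_kj(dT)` of the limit. -/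
def meanStep {M : ℕ} (A : Fin M → Fin M → Prop) (η ξ : Fin M → Fin M → ℝ) (δ : ℝ)
    (ν h : Fin M → ℝ) : ℝ :=
  ∑ k, ∑ j, ν k * h j * ∫ T, T * Real.exp (-δ * T) ∂(kernel A η ξ k j)

/-- The limit `G(i)`. -/
def renewalLimit {M : ℕ} (A : Fin M → Fin M → Prop) (η ξ : Fin M → Fin M → ℝ) (δ : ℝ)
    (ν h : Fin M → ℝ) (f : Fin M → ℝ → ℝ) (i : Fin M) : ℝ :=
  (h i * ∑ j, ν j * ∫ T, Real.exp (-δ * T) * f j T) / meanStep A η ξ δ ν h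

end MarkovRenewal

end

/-!
The renewal equation is solved by analysis alone; no probability space is used.

*Normalisation.* With `n_i(t) = e^{-δt} N(t, i) / h_i` and `g_i(t) = e^{-δt} f_i(t) / h_i` the
renewal equation becomes `n_i(t) = ∑_j P_ij n_j(t - x_ij) + g_i(t)`, where
`P_ij = B_ij(-δ) h_j / h_i` is a stochastic matrix with stationary vector `π_i = ν_i h_i` and
`x_ij = ξ̃(ji)`. Single steps `x_ij` may be negative, but since some Birkhoff sum of `ξ` is positive,
cheapest-path costs provide a potential `φ` with `x_ij + φ_i - φ_j ≥ c > 0` on all edges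
(`MarkovRenewal.exists_potential`). So the level `t + φ_i` drops by at least `c` in each transition.
The structure `RenewalChain` records these data.

*Consequences of the drift.* Information travels from `-∞` only, which gives a maximum principle
(`RenewalChain.nonpos_of_le_op`), hence comparison and uniqueness. The Neumann series converges
geometrically because `g` decays exponentially at `-∞` (`RenewalChain.isSolution_tsum`). Each cell
of a mesh of size at most `c` is met at most once, so solutions are bounded by the sum of the cell
suprema of `|g|` (`RenewalChain.IsSolution.abs_le_of_cell_bound`).

*Conservation law.* By stationarity the flux `∑ π_i P_ij ∫_{t - x_ij}^t n_j` equals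
`∑ π_i ∫_{-∞}^t g_i`, and so it tends to `L = ∑ π_i ∫ g_i`
(`RenewalChain.IsSolution.tendsto_flux_atTop`). This fixes the constant `L / ∑ π_i P_ij x_ij` in
both limit theorems.

*Time averages.* The averages of a bounded solution are harmonic for `P` up to `O(1/t)`. The
Dirichlet form `∑ π_i P_ij (a_i - a_j)^2` shows that they become independent of the state, and the
averaged flux identifies their limit (`RenewalChain.IsSolution.tendsto_average`).

*Non-lattice case.* If `ξ` is non-lattice, the lengths of loops generate a dense group, so path
lengths are asymptotically dense in the half-line. Let `g` be Lipschitz of compact support, so that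
`n` is uniformly continuous, and let `α` be the upper limit of `n`. Where `n_i(t)` is close to `α`,
the equation forces `n_j(t - s)` to be close to `α` for each path from `i` to `j` of length `s`;
by density, `n` is close to `α` on long windows, where the flux can be read off. This yields
`α = L / ∑ π_i P_ij x_ij` (`RenewalChain.eventually_le_of_nonArithmetic`), and the lower limit is
treated in the same way. Comparison extends the result to indicator functions of intervals,
dominated convergence to integrable step functions, and comparison again to all `g` that lie between
step functions with close integrals (`RenewalChain.IsSolution.tendsto_of_nonArithmetic`). Direct
Riemann integrability of `f` and the decay at `-∞` provide such step functions for `e^{-δt} f(t)`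
(`RiemannSandwich.exp_mul`).
-/

/-! ### Semi-Markov data with positive drift -/

/-- `StepReach P x i j s`: there is a path of positive length from `i` to `j` through edges of
positive probability, whose steps `x` add up to `s`. -/
inductive StepReach {ι : Type*} (P x : ι → ι → ℝ) : ι → ι → ℝ → Prop
  | edge {i j : ι} : 0 < P i j → StepReach P x i j (x i j)
  | trans {i j k : ι} {s s' : ℝ} : StepReach P x i j s → StepReach P x j k s' →
      StepReach P x i k (s + s')

/-- An irreducible Markov chain on a finite set with transition probabilities `P` and a
stationary vector `π` (strictly positive, not normalised), whose transition `i → j` takes the real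
"time" `x i j`. Individual steps may be negative, but there is a potential `φ` along which the
*level* `t + φ i` of a point `(i, t)` drops by at least `c > 0` in each transition
`(i, t) → (j, t - x i j)`. -/
structure RenewalChain (ι : Type*) [Fintype ι] where
  P : ι → ι → ℝ
  x : ι → ι → ℝ
  φ : ι → ℝ
  c : ℝ
  π : ι → ℝ
  c_pos : 0 < c
  P_nonneg : ∀ i j, 0 ≤ P i j
  P_sum : ∀ i, ∑ j, P i j = 1
  drift : ∀ i j, P i j ≠ 0 → c ≤ x i j + φ i - φ j
  π_pos : ∀ i, 0 < π i
  stationary : ∀ j, ∑ i, π i * P i j = π j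
  irreducible : ∀ i j, ∃ s, StepReach P x i j s

namespace RenewalChain

variable {ι : Type*} [Fintype ι] (C : RenewalChain ι)

/-- The transition operator `(g_j)_j ↦ (∑_j P i j * g_j(· - x i j))_i`. -/
def op (g : ι → ℝ → ℝ) : ι → ℝ → ℝ := fun i t => ∑ j, C.P i j * g j (t - C.x i j)

/-- `n` solves the renewal equation `n = op n + g` and is negligible at `-∞`. -/
structure IsSolution (g n : ι → ℝ → ℝ) : Prop where
  eq : ∀ i t, n i t = C.op n i t + g i t
  tendsto : ∀ i, Tendsto (n i) atBot (𝓝 0)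

/-- The mean step `∑ π i * P i j * x i j` (for the unnormalised stationary vector `π`). -/
def mean : ℝ := ∑ i, ∑ j, C.π i * C.P i j * C.x i j

variable {C}

lemma op_mono {g g' : ι → ℝ → ℝ} (h : ∀ i t, g i t ≤ g' i t) (i : ι) (t : ℝ) :
    C.op g i t ≤ C.op g' i t :=
  Finset.sum_le_sum fun j _ => mul_le_mul_of_nonneg_left (h _ _) (C.P_nonneg i j)

lemma op_le_of_forall_le {g : ι → ℝ → ℝ} {i : ι} {t b : ℝ}
    (h : ∀ j, C.P i j ≠ 0 → g j (t - C.x i j) ≤ b) : C.op g i t ≤ b := by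
  calc C.op g i t ≤ ∑ j, C.P i j * b := by
        refine Finset.sum_le_sum fun j _ => ?_
        by_cases hP : C.P i j = 0
        · simp [hP]
        · exact mul_le_mul_of_nonneg_left (h j hP) (C.P_nonneg i j)
    _ = b := by rw [← Finset.sum_mul, C.P_sum, one_mul]

lemma op_sub (g g' : ι → ℝ → ℝ) (i : ι) (t : ℝ) :
    C.op (fun i t => g i t - g' i t) i t = C.op g i t - C.op g' i t := by
  simp [op, mul_sub]

lemma op_neg (g : ι → ℝ → ℝ) (i : ι) (t : ℝ) :
    C.op (fun i t => -g i t) i t = -C.op g i t := by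
  simp [op]

lemma IsSolution.sub {g n g' n' : ι → ℝ → ℝ} (h : C.IsSolution g n) (h' : C.IsSolution g' n') :
    C.IsSolution (fun i t => g i t - g' i t) (fun i t => n i t - n' i t) where
  eq i t := by rw [op_sub, h.eq i t, h'.eq i t]; ring
  tendsto i := by simpa using (h.tendsto i).sub (h'.tendsto i)

lemma IsSolution.neg {g n : ι → ℝ → ℝ} (h : C.IsSolution g n) :
    C.IsSolution (fun i t => -g i t) (fun i t => -n i t) where
  eq i t := by rw [op_neg, h.eq i t]; ring
  tendsto i := by simpa using (h.tendsto i).neg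

lemma IsSolution.comp_add {g n : ι → ℝ → ℝ} (h : C.IsSolution g n) (v : ℝ) :
    C.IsSolution (fun i t => g i (t + v)) (fun i t => n i (t + v)) where
  eq i t := by
    rw [h.eq i (t + v)]
    simp only [op]
    congr 1
    refine Finset.sum_congr rfl fun j _ => ?_
    congr 2; ring
  tendsto i := (h.tendsto i).comp (tendsto_atBot_add_const_right _ _ tendsto_id)

variable (C) in
lemma exists_φ_bound : ∃ B, 0 ≤ B ∧ ∀ i, |C.φ i| ≤ B :=
  ⟨∑ i, |C.φ i|, Finset.sum_nonneg fun _ _ => abs_nonneg _, fun i =>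
    Finset.single_le_sum (f := fun i => |C.φ i|) (fun _ _ => abs_nonneg _) (Finset.mem_univ i)⟩

/-! ### Maximum principle -/

/-- Maximum principle: since the level drops by at least `c` in every transition, an inequality
`u ≤ op u` propagates the bound at `-∞` to the whole line. -/
lemma nonpos_of_le_op {u : ι → ℝ → ℝ} (hu : ∀ i t, u i t ≤ C.op u i t)
    (h0 : ∀ ε > 0, ∀ i, ∀ᶠ t in atBot, u i t ≤ ε) (i : ι) (t : ℝ) : u i t ≤ 0 := by
  refine le_of_forall_pos_le_add fun ε hε => ?_
  rw [zero_add]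
  obtain ⟨T, hT⟩ := eventually_atBot.1 (eventually_all.2 (h0 ε hε))
  obtain ⟨B, -, hB⟩ := C.exists_φ_bound
  have key : ∀ m : ℕ, ∀ i t, t + C.φ i ≤ T - B + m * C.c → u i t ≤ ε := by
    intro m
    induction m with
    | zero =>
      intro i t ht
      have := neg_le_of_abs_le (hB i)
      exact hT t (by simp at ht; linarith) i
    | succ m ih =>
      intro i t ht
      refine (hu i t).trans (op_le_of_forall_le fun j hP => ih j _ ?_)
      have := C.drift i j hP
      push_cast at ht
      linarith
  obtain ⟨m, hm⟩ := exists_nat_gt ((t + C.φ i - T + B) / C.c)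
  refine key m i t ?_
  rw [div_lt_iff₀ C.c_pos] at hm
  linarith

lemma IsSolution.le {g n g' n' : ι → ℝ → ℝ} (h : C.IsSolution g n) (h' : C.IsSolution g' n')
    (hg : ∀ i t, g i t ≤ g' i t) (i : ι) (t : ℝ) : n i t ≤ n' i t := by
  have hs := h.sub h'
  have := nonpos_of_le_op (C := C) (u := fun i t => n i t - n' i t)
    (fun i t => by
      have := hs.eq i t
      have := hg i t
      linarith)
    (fun ε hε i => (hs.tendsto i).eventually (eventually_le_nhds hε)) i t
  linarith

lemma IsSolution.unique {g n n' : ι → ℝ → ℝ} (h : C.IsSolution g n) (h' : C.IsSolution g n') :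
    n = n' := by
  ext i t
  exact le_antisymm (h.le h' (fun _ _ => le_rfl) i t) (h'.le h (fun _ _ => le_rfl) i t)

/-! ### Existence: the Neumann series -/

lemma abs_op_le (g : ι → ℝ → ℝ) (i : ι) (t : ℝ) :
    |C.op g i t| ≤ C.op (fun i t => |g i t|) i t := by
  refine (Finset.abs_sum_le_sum_abs _ _).trans (Finset.sum_le_sum fun j _ => ?_)
  rw [abs_mul, abs_of_nonneg (C.P_nonneg i j)]

lemma abs_iterate_op_le (g : ι → ℝ → ℝ) (m : ℕ) (i : ι) (t : ℝ) :
    |(C.op^[m] g) i t| ≤ (C.op^[m] (fun i t => |g i t|)) i t := by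
  induction m generalizing i t with
  | zero => simp
  | succ m ih =>
    rw [Function.iterate_succ_apply', Function.iterate_succ_apply']
    exact (abs_op_le _ i t).trans (op_mono ih i t)

/-- After `m` transitions the level has dropped by `m * c`, so exponential decay at `-∞` makes the
iterates of the transition operator decay geometrically. -/
lemma abs_iterate_op_le_exp {g : ι → ℝ → ℝ} {K s B : ℝ} (hB : ∀ i, |C.φ i| ≤ B) (hs : 0 ≤ s)
    (hK : 0 ≤ K) (hg : ∀ i, ∀ t < 0, |g i t| ≤ K * Real.exp (s * t)) (m : ℕ) (i : ι) (t : ℝ)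
    (ht : t + C.φ i + B < m * C.c) :
    |(C.op^[m] g) i t| ≤ K * Real.exp (s * (t + C.φ i + B - m * C.c)) := by
  refine (abs_iterate_op_le g m i t).trans ?_
  induction m generalizing i t with
  | zero =>
    have h1 := neg_le_of_abs_le (hB i)
    simp only [CharP.cast_eq_zero, zero_mul] at ht
    refine (hg i t (by linarith)).trans (mul_le_mul_of_nonneg_left (Real.exp_le_exp.2 ?_) hK)
    refine mul_le_mul_of_nonneg_left ?_ hs
    simp; linarith
  | succ m ih =>
    rw [Function.iterate_succ_apply']
    push_cast at ht ⊢
    refine op_le_of_forall_le fun j hP => ?_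
    have := C.drift i j hP
    refine (ih j _ (by linarith)).trans
      (mul_le_mul_of_nonneg_left (Real.exp_le_exp.2 (mul_le_mul_of_nonneg_left ?_ hs)) hK)
    linarith

lemma summable_iterate_op {g : ι → ℝ → ℝ} {K s : ℝ} (hs : 0 < s)
    (hK : 0 ≤ K) (hg : ∀ i, ∀ t < 0, |g i t| ≤ K * Real.exp (s * t)) (i : ι) (t : ℝ) :
    Summable fun m => (C.op^[m] g) i t := by
  obtain ⟨B, -, hB⟩ := C.exists_φ_bound
  have hr : Real.exp (-(s * C.c)) < 1 := Real.exp_lt_one_iff.2 (by nlinarith [C.c_pos])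
  refine Summable.of_norm_bounded_eventually_nat
    (g := fun m => K * Real.exp (s * (t + C.φ i + B)) * Real.exp (-(s * C.c)) ^ m)
    ((summable_geometric_of_lt_one (Real.exp_pos _).le hr).mul_left _) ?_
  obtain ⟨m₀, hm₀⟩ := exists_nat_gt ((t + C.φ i + B) / C.c)
  filter_upwards [eventually_ge_atTop m₀] with m hm
  rw [div_lt_iff₀ C.c_pos] at hm₀
  have hm' : (m₀ : ℝ) ≤ m := by exact_mod_cast hm
  refine (abs_iterate_op_le_exp hB hs.le hK hg m i t
    (hm₀.trans_le (mul_le_mul_of_nonneg_right hm' C.c_pos.le))).trans_eq ?_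
  rw [← Real.exp_nat_mul, mul_assoc, ← Real.exp_add]
  congr 2; ring

lemma isSolution_tsum {g : ι → ℝ → ℝ} {K s : ℝ} (hs : 0 < s)
    (hK : 0 ≤ K) (hg : ∀ i, ∀ t < 0, |g i t| ≤ K * Real.exp (s * t)) :
    C.IsSolution g (fun i t => ∑' m, (C.op^[m] g) i t) := by
  have hsum := fun i t => summable_iterate_op (C := C) hs hK hg i t
  refine ⟨fun i t => ?_, fun i => ?_⟩
  · rw [(hsum i t).tsum_eq_zero_add, add_comm, Function.iterate_zero_apply]
    congr 1
    simp only [Function.iterate_succ_apply', op]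
    rw [Summable.tsum_finsetSum fun j _ => (hsum j _).mul_left _]
    exact Finset.sum_congr rfl fun j _ => tsum_mul_left
  · obtain ⟨B, -, hB⟩ := C.exists_φ_bound
    set q := Real.exp (-(s * C.c)) with hq
    have hr : q < 1 := Real.exp_lt_one_iff.2 (by nlinarith [C.c_pos])
    have hlim : Tendsto (fun t => K * Real.exp (s * (t + C.φ i + B)) * (1 - q)⁻¹) atBot (𝓝 0) := by
      have : Tendsto (fun t : ℝ => s * (t + C.φ i + B)) atBot atBot :=
        (tendsto_atBot_add_const_right _ _
          (tendsto_atBot_add_const_right _ _ tendsto_id)).const_mul_atBot hs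
      simpa using ((Real.tendsto_exp_atBot.comp this).const_mul K).mul_const (1 - q)⁻¹
    refine squeeze_zero_norm' ?_ hlim
    filter_upwards [eventually_lt_atBot (-(C.φ i + B))] with t ht
    have hgeo := (hasSum_geometric_of_lt_one (Real.exp_pos _).le hr).mul_left
      (K * Real.exp (s * (t + C.φ i + B)))
    refine tsum_of_norm_bounded hgeo fun m => ?_
    refine (abs_iterate_op_le_exp hB hs.le hK hg m i t ?_).trans_eq ?_
    · have := mul_nonneg (Nat.cast_nonneg (α := ℝ) m) C.c_pos.le
      linarith
    · rw [← Real.exp_nat_mul, mul_assoc, ← Real.exp_add]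
      congr 2; ring

lemma exists_isSolution {g : ι → ℝ → ℝ} {T b : ℝ} (hb : ∀ i t, |g i t| ≤ b)
    (hg : ∀ i, ∀ t < T, g i t = 0) : ∃ n, C.IsSolution g n := by
  rcases isEmpty_or_nonempty ι with h | ⟨⟨i₀⟩⟩
  · exact ⟨fun i => isEmptyElim i, fun i => isEmptyElim i, fun i => isEmptyElim i⟩
  have hb0 : 0 ≤ b := (abs_nonneg _).trans (hb i₀ 0)
  refine ⟨_, isSolution_tsum (C := C) (K := b * Real.exp |T|) (s := 1) one_pos (by positivity)
    fun i t ht => ?_⟩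
  rcases lt_or_ge t T with h | h
  · rw [hg i t h]; simp; positivity
  · refine (hb i t).trans ?_
    rw [mul_assoc, ← Real.exp_add]
    refine le_mul_of_one_le_right hb0 (Real.one_le_exp ?_)
    have := neg_abs_le T
    linarith

/-! ### A bound in terms of the suprema on a mesh -/

/-- A solution is bounded by the sum of the suprema of the inhomogeneity over the cells of a mesh:
if the mesh size is at most `c`, then a trajectory meets each cell (of levels) at most once. -/
lemma IsSolution.le_of_cell_bound {g n : ι → ℝ → ℝ} (h : C.IsSolution g n) {r : ℝ} (hr : 0 < r)
    (hrc : r ≤ C.c) {m : ℤ → ℝ} (hm0 : ∀ k, 0 ≤ m k) (hm : Summable m)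
    (hg : ∀ i t, g i t ≤ m ⌊t / r⌋) (i : ι) (t : ℝ) :
    n i t ≤ 2 * Fintype.card ι * ∑' k, m k := by
  -- cell bounds as functions of the level instead of the time
  set d : ι → ℤ := fun i => ⌊C.φ i / r⌋ with hd
  set m' : ℤ → ℝ := fun k => ∑ i, (m (k - d i) + m (k - d i - 1)) with hm'
  have hsh : ∀ a : ℤ, HasSum (fun k => m (k - a)) (∑' k, m k) := fun a =>
    (Equiv.hasSum_iff (Equiv.subRight a)).2 hm.hasSum
  have hm's : HasSum m' (2 * Fintype.card ι * ∑' k, m k) := by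
    have : HasSum m' (∑ i : ι, (∑' k, m k + ∑' k, m k)) := by
      refine hasSum_sum fun i _ => (hsh (d i)).add ?_
      simpa only [sub_sub] using hsh (d i + 1)
    convert this using 1
    simp; ring
  have hm'0 : ∀ k, 0 ≤ m' k := fun k =>
    Finset.sum_nonneg fun i _ => add_nonneg (hm0 _) (hm0 _)
  have hgm' : ∀ i t, g i t ≤ m' ⌊(t + C.φ i) / r⌋ := by
    intro i t
    refine (hg i t).trans ?_
    have h2 : m (⌊(t + C.φ i) / r⌋ - d i) + m (⌊(t + C.φ i) / r⌋ - d i - 1)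
        ≤ m' ⌊(t + C.φ i) / r⌋ :=
      Finset.single_le_sum
        (f := fun j => m (⌊(t + C.φ i) / r⌋ - d j) + m (⌊(t + C.φ i) / r⌋ - d j - 1))
        (fun i _ => add_nonneg (hm0 _) (hm0 _)) (Finset.mem_univ i)
    have h3 : ⌊t / r⌋ = ⌊(t + C.φ i) / r⌋ - d i ∨ ⌊t / r⌋ = ⌊(t + C.φ i) / r⌋ - d i - 1 := by
      have e1 : ⌊t / r⌋ + d i ≤ ⌊(t + C.φ i) / r⌋ := by
        rw [add_div]; exact Int.le_floor_add _ _
      have e2 : ⌊(t + C.φ i) / r⌋ ≤ ⌊t / r⌋ + d i + 1 := by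
        rw [add_div]
        have := Int.le_floor_add_floor (t / r) (C.φ i / r)
        simp only [hd]; omega
      omega
    rcases h3 with e | e
    · rw [e]; linarith [hm0 (⌊(t + C.φ i) / r⌋ - d i - 1)]
    · rw [e]; linarith [hm0 (⌊(t + C.φ i) / r⌋ - d i)]
  -- the barrier: the sum of the bounds over all cells below the current one
  set W : ℤ → ℝ := fun k => ∑' l : ℕ, m' (k - l) with hW
  have hinj : ∀ k : ℤ, Function.Injective fun l : ℕ => k - (l : ℤ) := by
    intro k a b hab
    simpa using hab
  have hWs : ∀ k, Summable fun l : ℕ => m' (k - l) := fun k =>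
    hm's.summable.comp_injective (hinj k)
  have hWsucc : ∀ k, W k = m' k + W (k - 1) := by
    intro k
    simp only [hW]
    rw [(hWs k).tsum_eq_zero_add]
    simp only [Nat.cast_zero, sub_zero, Nat.cast_add, Nat.cast_one]
    congr 2
    ext l
    congr 1; ring
  have hWmono : Monotone W := monotone_int_of_le_succ fun k => by
    rw [hWsucc (k + 1)]
    simpa using hm'0 (k + 1)
  have hWle : ∀ k, W k ≤ 2 * Fintype.card ι * ∑' k, m k := fun k => by
    rw [← hm's.tsum_eq]
    exact tsum_comp_le_tsum_of_inj hm's.summable hm'0 (hinj k)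
  have hW0 : ∀ k, 0 ≤ W k := fun k => tsum_nonneg fun l => hm'0 _
  have key := nonpos_of_le_op (C := C) (u := fun i t => n i t - W ⌊(t + C.φ i) / r⌋)
    (fun i t => ?_) (fun ε hε i => ?_) i t
  · exact (sub_nonpos.1 key).trans (hWle _)
  · rw [op_sub (C := C) n (fun i t => W ⌊(t + C.φ i) / r⌋)]
    have h1 : C.op (fun i t => W ⌊(t + C.φ i) / r⌋) i t ≤ W (⌊(t + C.φ i) / r⌋ - 1) := by
      refine op_le_of_forall_le fun j hP => hWmono ?_
      rw [← Int.floor_sub_one]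
      refine Int.floor_le_floor ?_
      rw [div_sub_one hr.ne']
      have := C.drift i j hP
      gcongr
      linarith
    have h2 := h.eq i t
    have h3 := hgm' i t
    have h4 := hWsucc ⌊(t + C.φ i) / r⌋
    linarith
  · filter_upwards [(h.tendsto i).eventually (eventually_le_nhds hε)] with t ht
    linarith [hW0 ⌊(t + C.φ i) / r⌋]

lemma IsSolution.abs_le_of_cell_bound {g n : ι → ℝ → ℝ} (h : C.IsSolution g n) {r : ℝ}
    (hr : 0 < r) (hrc : r ≤ C.c) {m : ℤ → ℝ} (hm : Summable m)
    (hg : ∀ i t, |g i t| ≤ m ⌊t / r⌋) (i : ι) (t : ℝ) :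
    |n i t| ≤ 2 * Fintype.card ι * ∑' k, m k := by
  have hm0 : ∀ k, 0 ≤ m k := fun k => by
    have := (abs_nonneg _).trans (hg i (k * r))
    rwa [mul_div_cancel_right₀ _ hr.ne', Int.floor_intCast] at this
  refine abs_le'.2 ⟨h.le_of_cell_bound hr hrc hm0 hm (fun i t => (le_abs_self _).trans (hg i t)) i t,
    h.neg.le_of_cell_bound hr hrc hm0 hm (fun i t => (neg_le_abs _).trans (hg i t)) i t⟩

/-- For inhomogeneities supported in a fixed interval, the solution is bounded by a multiple of the
supremum of the inhomogeneity. -/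
lemma exists_bound_of_support (T : ℝ) : ∃ K, 0 ≤ K ∧ ∀ (g n : ι → ℝ → ℝ) (b : ℝ), 0 ≤ b →
    C.IsSolution g n → (∀ i t, |g i t| ≤ b) → (∀ i t, T < |t| → g i t = 0) →
    ∀ i t, |n i t| ≤ K * b := by
  classical
  set k₀ : ℤ := ⌈T / C.c⌉ + 1
  refine ⟨2 * Fintype.card ι * (Finset.Icc (-k₀) k₀).card, by positivity,
    fun g n b hb h hgb hg0 i t => ?_⟩
  set m : ℤ → ℝ := fun k => if k ∈ Finset.Icc (-k₀) k₀ then b else 0 with hm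
  have hms : ∀ k ∉ Finset.Icc (-k₀) k₀, m k = 0 := fun k hk => by simp only [hm, if_neg hk]
  have hsum : ∑' k, m k = (Finset.Icc (-k₀) k₀).card * b := by
    rw [tsum_eq_sum hms, Finset.sum_congr rfl (g := fun _ => b) (fun k hk => by
      simp only [hm, if_pos hk])]
    simp
  have := h.abs_le_of_cell_bound C.c_pos le_rfl (m := m) (summable_of_ne_finset_zero hms)
    (fun i t => ?_) i t
  · rw [hsum] at this
    linarith
  · by_cases hk : ⌊t / C.c⌋ ∈ Finset.Icc (-k₀) k₀
    · simp only [hm, if_pos hk]; exact hgb i t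
    · rw [hg0 i t, abs_zero]
      · simp only [hm, if_neg hk, le_rfl]
      · by_contra! hle
        apply hk
        have hc := C.c_pos
        have h1 : T / C.c ≤ ⌈T / C.c⌉ := Int.le_ceil _
        have h2 := abs_le.1 hle
        have h3 : t / C.c ≤ T / C.c := by gcongr; exact h2.2
        have h4 : -(T / C.c) ≤ t / C.c := by rw [← neg_div]; gcongr; exact h2.1
        rw [Finset.mem_Icc]
        constructor
        · refine Int.le_floor.2 ?_
          push_cast [k₀]; linarith
        · refine Int.floor_le_iff.2 ?_
          push_cast [k₀]; linarith

end RenewalChain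

namespace RenewalChain

variable {ι : Type*} [Fintype ι] {C : RenewalChain ι}

variable (C) in
lemma mean_pos [Nonempty ι] : 0 < C.mean := by
  have h1 : ∑ i, ∑ j, C.π i * C.P i j * C.φ i = ∑ i, ∑ j, C.π i * C.P i j * C.φ j := by
    rw [Finset.sum_comm (f := fun i j => C.π i * C.P i j * C.φ j)]
    refine Finset.sum_congr rfl fun i _ => ?_
    rw [← Finset.sum_mul, ← Finset.sum_mul, ← Finset.mul_sum, C.P_sum, C.stationary, mul_one]
  have h2 : C.mean = ∑ i, ∑ j, C.π i * C.P i j * (C.x i j + C.φ i - C.φ j) := by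
    simp only [mul_sub, mul_add, Finset.sum_add_distrib, Finset.sum_sub_distrib, h1, mean]
    ring
  have h3 : ∑ i, C.π i * C.c ≤ C.mean := by
    rw [h2]
    refine Finset.sum_le_sum fun i _ => ?_
    calc C.π i * C.c = ∑ j, C.π i * C.P i j * C.c := by
          rw [← Finset.sum_mul, ← Finset.mul_sum, C.P_sum, mul_one]
      _ ≤ _ := by
        refine Finset.sum_le_sum fun j _ => ?_
        by_cases hP : C.P i j = 0
        · simp [hP]
        · exact mul_le_mul_of_nonneg_left (C.drift i j hP)
            (mul_nonneg (C.π_pos i).le (C.P_nonneg i j))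
  exact (Finset.sum_pos (fun i _ => mul_pos (C.π_pos i) C.c_pos) Finset.univ_nonempty).trans_le h3

/-! ### Functions on the state space that are nearly harmonic -/

/-- Stationarity turns the Dirichlet form into the pairing of `a` with its defect from
harmonicity. -/
lemma dirichlet_form_eq (a : ι → ℝ) :
    ∑ i, ∑ j, C.π i * C.P i j * (a i - a j) ^ 2
      = 2 * ∑ i, C.π i * a i * (a i - ∑ j, C.P i j * a j) := by
  have h1 : ∑ i, ∑ j, C.π i * C.P i j * a i ^ 2 = ∑ i, C.π i * a i ^ 2 := by
    refine Finset.sum_congr rfl fun i _ => ?_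
    rw [← Finset.sum_mul, ← Finset.mul_sum, C.P_sum, mul_one]
  have h2 : ∑ i, ∑ j, C.π i * C.P i j * a j ^ 2 = ∑ i, C.π i * a i ^ 2 := by
    rw [Finset.sum_comm]
    refine Finset.sum_congr rfl fun i _ => ?_
    rw [← Finset.sum_mul, C.stationary]
  have h3 : ∀ i j, C.π i * C.P i j * (a i - a j) ^ 2 = C.π i * C.P i j * a i ^ 2
      + C.π i * C.P i j * a j ^ 2 - 2 * (C.π i * a i * (C.P i j * a j)) := fun i j => by ring
  simp only [h3, Finset.sum_add_distrib, Finset.sum_sub_distrib, h1, h2, mul_sub,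
    ← Finset.mul_sum]
  have h4 : ∀ i, C.π i * a i * a i = C.π i * a i ^ 2 := fun i => by ring
  simp only [h4]
  ring

/-- Bounded functions on the state space that are asymptotically harmonic are asymptotically
constant. -/
lemma tendsto_sub_of_tendsto_defect {α : Type*} {l : Filter α} {a : ι → α → ℝ} {K : ℝ}
    (hK : ∀ i t, |a i t| ≤ K)
    (ha : ∀ i, Tendsto (fun t => a i t - ∑ j, C.P i j * a j t) l (𝓝 0)) (i j : ι) :
    Tendsto (fun t => a i t - a j t) l (𝓝 0) := by
  have hD : Tendsto (fun t => ∑ i, ∑ j, C.π i * C.P i j * (a i t - a j t) ^ 2) l (𝓝 0) := by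
    simp only [fun t => dirichlet_form_eq (C := C) (fun i => a i t)]
    have : ∀ i, Tendsto (fun t => C.π i * a i t * (a i t - ∑ j, C.P i j * a j t)) l (𝓝 0) := by
      intro i
      refine squeeze_zero_norm (a := fun t => C.π i * K * |a i t - ∑ j, C.P i j * a j t|)
        (fun t => ?_) (by simpa using (ha i).abs.const_mul (C.π i * K))
      rw [norm_mul, norm_mul, Real.norm_eq_abs, Real.norm_eq_abs, Real.norm_eq_abs,
        abs_of_pos (C.π_pos i)]
      exact mul_le_mul_of_nonneg_right (mul_le_mul_of_nonneg_left (hK i t) (C.π_pos i).le)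
        (abs_nonneg _)
    simpa using (tendsto_finsetSum Finset.univ fun i _ => this i).const_mul 2
  have hedge : ∀ i j, 0 < C.P i j → Tendsto (fun t => a i t - a j t) l (𝓝 0) := by
    intro i j hP
    have hw : 0 < C.π i * C.P i j := mul_pos (C.π_pos i) hP
    have hsq : Tendsto (fun t => (a i t - a j t) ^ 2) l (𝓝 0) := by
      refine squeeze_zero (fun t => sq_nonneg _)
        (g := fun t => (C.π i * C.P i j)⁻¹ * ∑ i, ∑ j, C.π i * C.P i j * (a i t - a j t) ^ 2)
        (fun t => ?_) (by simpa using hD.const_mul (C.π i * C.P i j)⁻¹)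
      rw [le_inv_mul_iff₀ hw]
      have h0 : ∀ i j, 0 ≤ C.π i * C.P i j * (a i t - a j t) ^ 2 := fun i j =>
        mul_nonneg (mul_nonneg (C.π_pos i).le (C.P_nonneg i j)) (sq_nonneg _)
      exact (Finset.single_le_sum (f := fun j => C.π i * C.P i j * (a i t - a j t) ^ 2)
          (fun j _ => h0 i j) (Finset.mem_univ j)).trans
        (Finset.single_le_sum (f := fun i => ∑ j, C.π i * C.P i j * (a i t - a j t) ^ 2)
          (fun i _ => Finset.sum_nonneg fun j _ => h0 i j) (Finset.mem_univ i))
    rw [tendsto_zero_iff_abs_tendsto_zero]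
    simpa [Function.comp_def, Real.sqrt_sq_eq_abs] using hsq.sqrt
  obtain ⟨s, hs⟩ := C.irreducible i j
  induction hs with
  | edge hP => exact hedge _ _ hP
  | trans _ _ h1 h2 => simpa using h1.add h2

/-! ### The flux through a moving time -/

/-- The `π`-weighted flux of `n` across time `t`. -/
noncomputable def flux (C : RenewalChain ι) (n : ι → ℝ → ℝ) (t : ℝ) : ℝ :=
  ∑ i, ∑ j, C.π i * C.P i j * ∫ s in (t - C.x i j)..t, n j s

lemma intervalIntegrable_of_abs_le {f : ℝ → ℝ} {K : ℝ} (hf : AEStronglyMeasurable f)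
    (hK : ∀ t, |f t| ≤ K) (a b : ℝ) : IntervalIntegrable f volume a b := by
  rw [intervalIntegrable_iff]
  exact Measure.integrableOn_of_bounded (M := K) (by simp) hf
    (Eventually.of_forall fun t => hK t)

lemma IsSolution.integral_eq {g n : ι → ℝ → ℝ} (h : C.IsSolution g n)
    (hg : ∀ i a b, IntervalIntegrable (g i) volume a b)
    (hn : ∀ i a b, IntervalIntegrable (n i) volume a b) (i : ι) (a b : ℝ) :
    ∫ s in a..b, n i s
      = ∑ j, C.P i j * (∫ s in (a - C.x i j)..(b - C.x i j), n j s) + ∫ s in a..b, g i s := by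
  have h1 : ∀ j, IntervalIntegrable (fun s => C.P i j * n j (s - C.x i j)) volume a b := fun j => by
    simpa using ((hn j (a - C.x i j) (b - C.x i j)).comp_sub_right (C.x i j)).const_mul (C.P i j)
  have h2 : IntervalIntegrable (C.op n i) volume a b := by
    have := IntervalIntegrable.sum Finset.univ (fun j _ => h1 j)
    rwa [Finset.sum_fn] at this
  rw [funext (h.eq i), intervalIntegral.integral_add h2 (hg i a b)]
  simp only [op]
  rw [intervalIntegral.integral_finsetSum fun j _ => h1 j]
  congr 1
  refine Finset.sum_congr rfl fun j _ => ?_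
  rw [intervalIntegral.integral_const_mul, intervalIntegral.integral_comp_sub_right]

/-- Conservation law: by stationarity of `π` the flux changes only through the inhomogeneity. -/
lemma IsSolution.flux_sub_flux {g n : ι → ℝ → ℝ} (h : C.IsSolution g n)
    (hg : ∀ i a b, IntervalIntegrable (g i) volume a b)
    (hn : ∀ i a b, IntervalIntegrable (n i) volume a b) (a b : ℝ) :
    C.flux n b - C.flux n a = ∑ i, C.π i * ∫ s in a..b, g i s := by
  have h1 : ∀ i j, (∫ s in (b - C.x i j)..b, n j s) - ∫ s in (a - C.x i j)..a, n j s
      = (∫ s in a..b, n j s) - ∫ s in (a - C.x i j)..(b - C.x i j), n j s := fun i j =>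
    (intervalIntegral.integral_interval_sub_interval_comm (hn j _ _) (hn j _ _)
      (hn j _ _)).trans (by
        rw [intervalIntegral.integral_symm b a, intervalIntegral.integral_symm (b - C.x i j)]; ring)
  have h2 : ∑ i, ∑ j, C.π i * C.P i j * (∫ s in a..b, n j s) = ∑ i, C.π i * ∫ s in a..b, n i s := by
    rw [Finset.sum_comm]
    refine Finset.sum_congr rfl fun i _ => ?_
    rw [← Finset.sum_mul, C.stationary]
  have h3 : ∀ i, ∑ j, C.π i * C.P i j * (∫ s in (a - C.x i j)..(b - C.x i j), n j s)
      = C.π i * ((∫ s in a..b, n i s) - ∫ s in a..b, g i s) := fun i => by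
    rw [h.integral_eq hg hn i a b, add_sub_cancel_right, Finset.mul_sum]
    exact Finset.sum_congr rfl fun j _ => by ring
  simp only [flux, ← Finset.sum_sub_distrib, ← mul_sub, h1]
  simp only [mul_sub, Finset.sum_sub_distrib, h2]
  simp only [h3, ← Finset.sum_sub_distrib]
  exact Finset.sum_congr rfl fun i _ => by ring

lemma abs_integral_sub_mul_le {f : ℝ → ℝ} {a b y ε : ℝ} (hf : IntervalIntegrable f volume a b)
    (h : ∀ s ∈ uIoc a b, |f s - y| ≤ ε) : |(∫ s in a..b, f s) - (b - a) * y| ≤ ε * |b - a| := by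
  have h1 : (∫ s in a..b, f s) - (b - a) * y = ∫ s in a..b, (f s - y) := by
    rw [intervalIntegral.integral_sub hf intervalIntegrable_const]
    simp
  rw [h1, ← Real.norm_eq_abs]
  exact intervalIntegral.norm_integral_le_of_norm_le_const fun s hs => h s hs

lemma IsSolution.tendsto_flux_atBot {g n : ι → ℝ → ℝ} (h : C.IsSolution g n) :
    Tendsto (C.flux n) atBot (𝓝 0) := by
  have h1 : ∀ i j, Tendsto (fun t => ∫ s in (t - C.x i j)..t, n j s) atBot (𝓝 0) := by
    intro i j
    rw [Metric.tendsto_nhds]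
    intro ε hε
    set ε' := ε / (|C.x i j| + 1)
    have hε' : 0 < ε' := by positivity
    obtain ⟨T, hT⟩ := eventually_atBot.1 ((h.tendsto j).eventually (Metric.ball_mem_nhds 0 hε'))
    filter_upwards [eventually_le_atBot (T - |C.x i j|)] with t ht
    have h2 := intervalIntegral.norm_integral_le_of_norm_le_const (f := n j) (C := ε')
      (a := t - C.x i j) (b := t) (fun s hs => by
        have h3 : s ≤ T := by
          have := hs.2
          have h4 := neg_le_abs (C.x i j)
          have h5 := abs_nonneg (C.x i j)
          rcases le_total (t - C.x i j) t with h | h <;> simp [h] at this <;> linarith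
        simpa using (hT s h3).le)
    rw [dist_zero_right]
    refine h2.trans_lt ?_
    rw [sub_sub_cancel]
    calc ε' * |C.x i j| < ε' * (|C.x i j| + 1) := by gcongr; linarith
      _ = ε := by simp only [ε']; field_simp
  have := tendsto_finsetSum Finset.univ fun i _ => tendsto_finsetSum Finset.univ
    fun j _ => (h1 i j).const_mul (C.π i * C.P i j)
  simp only [mul_zero, Finset.sum_const_zero] at this
  exact this

/-- At `+∞` the flux tends to the total weighted mass of the inhomogeneity. -/
lemma IsSolution.tendsto_flux_atTop {g n : ι → ℝ → ℝ} (h : C.IsSolution g n)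
    (hg : ∀ i, Integrable (g i)) (hn : ∀ i a b, IntervalIntegrable (n i) volume a b) :
    Tendsto (C.flux n) atTop (𝓝 (∑ i, C.π i * ∫ s, g i s)) := by
  have h1 : Tendsto (fun t => C.flux n t - C.flux n (-t)) atTop
      (𝓝 (∑ i, C.π i * ∫ s, g i s)) := by
    simp only [fun t => h.flux_sub_flux (fun i a b => (hg i).intervalIntegrable) hn (-t) t]
    exact tendsto_finsetSum _ fun i _ =>
      (intervalIntegral_tendsto_integral (hg i) tendsto_neg_atTop_atBot tendsto_id).const_mul _
  simpa using h1.add (h.tendsto_flux_atBot.comp tendsto_neg_atTop_atBot)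

/-! ### Convergence of time averages -/

lemma tendsto_average_of_tendsto {f : ℝ → ℝ} {L : ℝ} (hf : ∀ a b, IntervalIntegrable f volume a b)
    (h : Tendsto f atTop (𝓝 L)) :
    Tendsto (fun t : ℝ => t⁻¹ * ∫ s in (0 : ℝ)..t, f s) atTop (𝓝 L) := by
  rw [Metric.tendsto_nhds]
  intro ε hε
  obtain ⟨T, hT⟩ := eventually_atTop.1 (h.eventually (Metric.ball_mem_nhds L (half_pos hε)))
  set T₀ := max T 0
  have h1 : Tendsto (fun t : ℝ => t⁻¹ * |(∫ s in (0 : ℝ)..T₀, f s) - T₀ * L|) atTop (𝓝 0) := by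
    simpa using tendsto_inv_atTop_zero.mul_const |(∫ s in (0 : ℝ)..T₀, f s) - T₀ * L|
  filter_upwards [h1.eventually (gt_mem_nhds (half_pos hε)), eventually_gt_atTop T₀] with t ht htT
  have ht0 : 0 < t := (le_max_right T 0).trans_lt htT
  have h2 := abs_integral_sub_mul_le (hf T₀ t) (y := L) (ε := ε / 2) fun s hs => by
    rw [uIoc_of_le htT.le] at hs
    exact (hT s ((le_max_left T 0).trans hs.1.le)).le
  have h3 : t⁻¹ * (∫ s in (0 : ℝ)..t, f s) - L
      = t⁻¹ * ((∫ s in (0 : ℝ)..T₀, f s) - T₀ * L) + t⁻¹ * ((∫ s in T₀..t, f s) - (t - T₀) * L) := by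
    rw [← intervalIntegral.integral_add_adjacent_intervals (hf 0 T₀) (hf T₀ t)]
    field_simp
    ring
  rw [Real.dist_eq, h3]
  refine (abs_add_le _ _).trans_lt ?_
  rw [abs_mul, abs_mul, abs_of_pos (inv_pos.2 ht0)]
  have h4 : t⁻¹ * |(∫ s in T₀..t, f s) - (t - T₀) * L| ≤ ε / 2 := by
    rw [inv_mul_le_iff₀ ht0]
    refine h2.trans ?_
    rw [abs_of_pos (sub_pos.2 htT), mul_comm t]
    have : 0 ≤ T₀ := le_max_right T 0
    gcongr
    linarith
  linarith

lemma tendsto_inv_mul_of_abs_le {f : ℝ → ℝ} {D : ℝ} (hD : ∀ t, |f t| ≤ D) :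
    Tendsto (fun t : ℝ => t⁻¹ * f t) atTop (𝓝 0) := by
  refine squeeze_zero_norm' (a := fun t => t⁻¹ * D) ?_
    (by simpa using tendsto_inv_atTop_zero.mul_const D)
  filter_upwards [eventually_gt_atTop 0] with t ht
  rw [norm_mul, Real.norm_eq_abs, Real.norm_eq_abs, abs_of_pos (inv_pos.2 ht)]
  exact mul_le_mul_of_nonneg_left (hD t) (inv_pos.2 ht).le

/-- The time averages of a bounded solution converge. They become independent of the state because
they are asymptotically harmonic, and their common limit is read off from the flux: integrating the
flux over `[0, t]` gives `∑ π i * P i j * x i j * ∫_0^t n j` up to a bounded error. -/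
theorem IsSolution.tendsto_average [Nonempty ι] {g n : ι → ℝ → ℝ} (h : C.IsSolution g n)
    (hg : ∀ i, Integrable (g i)) {K : ℝ} (hK : ∀ i t, |n i t| ≤ K)
    (hnm : ∀ i, AEStronglyMeasurable (n i)) (i : ι) :
    Tendsto (fun t : ℝ => t⁻¹ * ∫ s in (0 : ℝ)..t, n i s) atTop
      (𝓝 ((∑ i, C.π i * ∫ s, g i s) / C.mean)) := by
  have hn : ∀ i a b, IntervalIntegrable (n i) volume a b := fun i a b =>
    intervalIntegrable_of_abs_le (hnm i) (hK i) a b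
  set L := ∑ i, C.π i * ∫ s, g i s with hL
  set V : ι → ℝ → ℝ := fun i t => ∫ s in (0 : ℝ)..t, n i s with hV
  have hVsub : ∀ i a b, V i b - V i a = ∫ s in a..b, n i s := fun i a b =>
    intervalIntegral.integral_interval_sub_left (hn i _ _) (hn i _ _)
  have hVlip : ∀ i a b, |V i b - V i a| ≤ K * |b - a| := fun i a b => by
    rw [hVsub, ← Real.norm_eq_abs]
    exact intervalIntegral.norm_integral_le_of_norm_le_const fun s _ => hK i s
  have hVcont : ∀ i, Continuous (V i) := fun i =>
    intervalIntegral.continuous_primitive (fun a b => hn i a b) 0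
  have hVint : ∀ i a b, IntervalIntegrable (V i) volume a b := fun i a b =>
    (hVcont i).intervalIntegrable a b
  -- the averages become independent of the state
  have hdiff : ∀ i j, Tendsto (fun t : ℝ => t⁻¹ * V i t - t⁻¹ * V j t) atTop (𝓝 0) := by
    refine tendsto_sub_of_tendsto_defect (C := C) (K := K) (fun i t => ?_) fun i => ?_
    · have := hVlip i 0 t
      simp only [hV, intervalIntegral.integral_same, sub_zero] at this
      rw [abs_mul, abs_inv]
      rcases eq_or_ne t 0 with rfl | ht
      · simpa using (abs_nonneg _).trans (hK i 0)
      · rw [inv_mul_le_iff₀ (abs_pos.2 ht), mul_comm]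
        exact this
    · have h1 : ∀ t, |V i t - ∑ j, C.P i j * V j t|
          ≤ ∑ j, C.P i j * (2 * K * |C.x i j|) + ∫ s, |g i s| := by
        intro t
        have h2 : V i t - ∑ j, C.P i j * V j t = ∑ j, C.P i j * ((V j (t - C.x i j) - V j t)
            - (V j (0 - C.x i j) - V j 0)) + ∫ s in (0 : ℝ)..t, g i s := by
          have h3 := h.integral_eq (fun i a b => (hg i).intervalIntegrable) hn i 0 t
          have h4 : ∀ j, V j 0 = 0 := fun j => by simp [hV]
          simp only [← hVsub, h4, sub_zero] at h3
          rw [h3]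
          simp only [h4, mul_sub, Finset.sum_sub_distrib, sub_zero]
          ring
        rw [h2]
        refine (abs_add_le _ _).trans (add_le_add ?_ ?_)
        · refine (Finset.abs_sum_le_sum_abs _ _).trans (Finset.sum_le_sum fun j _ => ?_)
          rw [abs_mul, abs_of_nonneg (C.P_nonneg i j)]
          refine mul_le_mul_of_nonneg_left ((abs_sub _ _).trans ?_) (C.P_nonneg i j)
          have e1 := hVlip j t (t - C.x i j)
          have e2 := hVlip j 0 (0 - C.x i j)
          rw [show t - C.x i j - t = -C.x i j by ring, abs_neg] at e1
          rw [show 0 - C.x i j - 0 = -C.x i j by ring, abs_neg] at e2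
          linarith
        · rw [← Real.norm_eq_abs]
          refine (intervalIntegral.norm_integral_le_integral_norm_uIoc).trans ?_
          exact setIntegral_le_integral (hg i).abs (Eventually.of_forall fun s => abs_nonneg _)
      convert tendsto_inv_mul_of_abs_le h1 using 2 with t
      rw [mul_sub, Finset.mul_sum]
      congr 1
      exact Finset.sum_congr rfl fun j _ => by ring
  -- the integrated flux
  have hflux : ∀ t, C.flux n t = ∑ i, ∑ j, C.π i * C.P i j * (V j t - V j (t - C.x i j)) :=
    fun t => by simp only [flux, hVsub]
  have hterm : ∀ i j, Continuous fun t => C.π i * C.P i j * (V j t - V j (t - C.x i j)) :=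
    fun i j => continuous_const.mul
      ((hVcont j).sub ((hVcont j).comp (continuous_id.sub continuous_const)))
  have hfluxc : Continuous (C.flux n) := by
    rw [funext hflux]
    exact continuous_finsetSum _ fun i _ => continuous_finsetSum _ fun j _ => hterm i j
  have hfluxint : ∀ t, ∫ s in (0 : ℝ)..t, C.flux n s
      = ∑ i, ∑ j, C.π i * C.P i j
        * ((∫ s in (t - C.x i j)..t, V j s) - ∫ s in (0 - C.x i j)..0, V j s) := by
    intro t
    simp only [hflux]
    rw [intervalIntegral.integral_finsetSum fun i _ =>
      (continuous_finsetSum _ fun j _ => hterm i j).intervalIntegrable _ _]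
    refine Finset.sum_congr rfl fun i _ => ?_
    rw [intervalIntegral.integral_finsetSum fun j _ => (hterm i j).intervalIntegrable _ _]
    refine Finset.sum_congr rfl fun j _ => ?_
    have h1 : IntervalIntegrable (fun s => V j (s - C.x i j)) volume 0 t :=
      ((hVcont j).comp (continuous_sub_right (C.x i j))).intervalIntegrable _ _
    rw [intervalIntegral.integral_const_mul, intervalIntegral.integral_sub (hVint j _ _) h1,
      intervalIntegral.integral_comp_sub_right]
    congr 1
    rw [intervalIntegral.integral_interval_sub_interval_comm (hVint j _ _) (hVint j _ _)
      (hVint j _ _), intervalIntegral.integral_symm (t - C.x i j) t,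
      intervalIntegral.integral_symm (0 - C.x i j) 0]
    ring
  have herr : ∀ t, |(∫ s in (0 : ℝ)..t, C.flux n s) - ∑ i, ∑ j, C.π i * C.P i j * C.x i j * V j t|
      ≤ ∑ i, ∑ j, C.π i * C.P i j
        * (K * |C.x i j| * |C.x i j| + |∫ s in (0 - C.x i j)..0, V j s|) := by
    intro t
    rw [hfluxint]
    simp only [← Finset.sum_sub_distrib]
    refine (Finset.abs_sum_le_sum_abs _ _).trans (Finset.sum_le_sum fun i _ => ?_)
    refine (Finset.abs_sum_le_sum_abs _ _).trans (Finset.sum_le_sum fun j _ => ?_)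
    rw [mul_assoc (C.π i * C.P i j), ← mul_sub, abs_mul,
      abs_of_nonneg (mul_nonneg (C.π_pos i).le (C.P_nonneg i j))]
    refine mul_le_mul_of_nonneg_left ?_ (mul_nonneg (C.π_pos i).le (C.P_nonneg i j))
    rw [sub_right_comm]
    refine (abs_sub _ _).trans (add_le_add_left ?_ _)
    have h1 := abs_integral_sub_mul_le (hVint j (t - C.x i j) t) (y := V j t)
      (ε := K * |C.x i j|) fun s hs => by
        refine (hVlip j t s).trans ?_
        have hK0 : 0 ≤ K := (abs_nonneg _).trans (hK j 0)
        refine mul_le_mul_of_nonneg_left ?_ hK0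
        have h2 := Set.abs_sub_right_of_mem_uIcc (uIoc_subset_uIcc hs)
        rwa [abs_sub_comm, sub_sub_cancel] at h2
    rwa [sub_sub_cancel] at h1
  have hsum : Tendsto (fun t : ℝ => ∑ i, ∑ j, C.π i * C.P i j * C.x i j * (t⁻¹ * V j t)) atTop
      (𝓝 L) := by
    have h1 := (tendsto_average_of_tendsto (fun a b => hfluxc.intervalIntegrable a b)
      (h.tendsto_flux_atTop hg hn)).sub (tendsto_inv_mul_of_abs_le herr)
    rw [sub_zero] at h1
    refine h1.congr fun t => ?_
    rw [← mul_sub, sub_sub_cancel, Finset.mul_sum]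
    refine Finset.sum_congr rfl fun i _ => ?_
    rw [Finset.mul_sum]
    exact Finset.sum_congr rfl fun j _ => by ring
  have hmean : Tendsto (fun t : ℝ => C.mean * (t⁻¹ * V i t)) atTop (𝓝 L) := by
    have h1 := hsum.add (tendsto_finsetSum Finset.univ fun k _ => tendsto_finsetSum Finset.univ
      fun j _ => (hdiff i j).const_mul (C.π k * C.P k j * C.x k j))
    simp only [mul_zero, Finset.sum_const_zero, add_zero] at h1
    refine h1.congr fun t => ?_
    rw [← Finset.sum_add_distrib, mean, Finset.sum_mul]
    refine Finset.sum_congr rfl fun k _ => ?_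
    rw [← Finset.sum_add_distrib, Finset.sum_mul]
    exact Finset.sum_congr rfl fun j _ => by ring
  have := hmean.div_const C.mean
  simpa [mul_div_cancel_left₀ _ C.mean_pos.ne'] using this

end RenewalChain

/-! ### Asymptotic density of path lengths -/

/-- An additive semigroup of positive reals that generates a dense group comes eventually
arbitrarily close to every real: if `b` and `b + d` with `0 < d < ε` belong to it, then so do the
points `n * b + k * d`, `0 ≤ k < n`, and these are `ε`-dense far to the right. -/
lemma exists_abs_sub_lt_of_dense_closure {Γ : Set ℝ} (hadd : ∀ a ∈ Γ, ∀ b ∈ Γ, a + b ∈ Γ)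
    (hpos : ∀ a ∈ Γ, 0 < a) (hne : Γ.Nonempty)
    (hd : Dense (AddSubgroup.closure Γ : Set ℝ)) {ε : ℝ} (hε : 0 < ε) :
    ∃ T, ∀ t ≥ T, ∃ a ∈ Γ, |a - t| < ε := by
  have hdiff : ∀ z ∈ AddSubgroup.closure Γ, ∃ a ∈ Γ, ∃ b ∈ Γ, z = a - b := by
    intro z hz
    induction hz using AddSubgroup.closure_induction with
    | mem z hz => exact ⟨z + z, hadd z hz z hz, z, hz, by ring⟩
    | zero => obtain ⟨a, ha⟩ := hne; exact ⟨a, ha, a, ha, by ring⟩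
    | add y z _ _ hy hz =>
      obtain ⟨a, ha, b, hb, rfl⟩ := hy
      obtain ⟨a', ha', b', hb', rfl⟩ := hz
      exact ⟨a + a', hadd a ha a' ha', b + b', hadd b hb b' hb', by ring⟩
    | neg z _ hz =>
      obtain ⟨a, ha, b, hb, rfl⟩ := hz
      exact ⟨b, hb, a, ha, by ring⟩
  obtain ⟨d, hdmem, hd0, hdε⟩ := hd.exists_between hε
  obtain ⟨a, ha, b, hb, hab⟩ := hdiff d hdmem
  have hb0 := hpos b hb
  have hmul : ∀ m k : ℕ, (k : ℝ) * a + (m + 1) * b ∈ Γ := by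
    intro m k
    induction k with
    | zero =>
      induction m with
      | zero => simpa using hb
      | succ m ih =>
        have := hadd _ ih b hb
        convert this using 1
        push_cast; ring
    | succ k ih =>
      have := hadd _ ih a ha
      convert this using 1
      push_cast; ring
  obtain ⟨n₀, hn₀⟩ := exists_nat_gt (b / d)
  rw [div_lt_iff₀ hd0] at hn₀
  refine ⟨(n₀ + 1) * b, fun t ht => ?_⟩
  have ht0 : 0 ≤ t / b := by
    have : 0 ≤ ((n₀ : ℝ) + 1) * b := by positivity
    exact div_nonneg (this.trans ht) hb0.le
  set n := ⌊t / b⌋₊ with hn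
  have hnt : (n : ℝ) * b ≤ t := by
    have := Nat.floor_le ht0
    rwa [le_div_iff₀ hb0] at this
  have htn : t < (n + 1) * b := by
    have := Nat.lt_floor_add_one (t / b)
    rwa [div_lt_iff₀ hb0] at this
  have hn₀n : n₀ + 1 ≤ n := by
    refine Nat.le_floor ?_
    rw [le_div_iff₀ hb0]
    exact_mod_cast ht
  set k := ⌊(t - n * b) / d⌋₊ with hk
  have hkd : (k : ℝ) * d ≤ t - n * b := by
    have := Nat.floor_le (div_nonneg (sub_nonneg.2 hnt) hd0.le)
    rwa [le_div_iff₀ hd0] at this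
  have hdk : t - n * b < (k + 1) * d := by
    have := Nat.lt_floor_add_one ((t - n * b) / d)
    rwa [div_lt_iff₀ hd0] at this
  have hkn : k + 1 ≤ n := by
    have h1 : (k : ℝ) < n₀ := by
      by_contra! h
      have : (n₀ : ℝ) * d ≤ k * d := by gcongr
      linarith
    have : k < n₀ := by exact_mod_cast h1
    omega
  obtain ⟨m, hm⟩ := Nat.exists_eq_add_of_le hkn
  have hm' : (n : ℝ) = k + 1 + m := by exact_mod_cast hm
  refine ⟨k * a + (m + 1) * b, hmul m k, ?_⟩
  rw [abs_lt]
  have : (k : ℝ) * a + (m + 1) * b = n * b + k * d := by rw [hm', hab]; ring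
  constructor <;> linarith

namespace RenewalChain

variable {ι : Type*} [Fintype ι] {C : RenewalChain ι}

/-- The chain is non-arithmetic if, at each state, the lengths of the loops generate a dense
subgroup of `ℝ`. -/
def NonArithmetic (C : RenewalChain ι) : Prop :=
  ∀ i, Dense (AddSubgroup.closure {s | StepReach C.P C.x i i s} : Set ℝ)

lemma le_of_stepReach {i j : ι} {s : ℝ} (h : StepReach C.P C.x i j s) :
    C.c ≤ s + C.φ i - C.φ j := by
  induction h with
  | edge hP => exact C.drift _ _ hP.ne'
  | trans _ _ h1 h2 => linarith [C.c_pos]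

lemma NonArithmetic.exists_stepReach (hC : C.NonArithmetic) (i j : ι) {ε : ℝ} (hε : 0 < ε) :
    ∃ T, ∀ t ≥ T, ∃ s, StepReach C.P C.x i j s ∧ |s - t| < ε := by
  obtain ⟨s₀, hs₀⟩ := C.irreducible i j
  obtain ⟨T, hT⟩ := exists_abs_sub_lt_of_dense_closure (Γ := {s | StepReach C.P C.x i i s})
    (fun a ha b hb => ha.trans hb)
    (fun a ha => by have := le_of_stepReach ha; linarith [C.c_pos]) (C.irreducible i i) (hC i) hε
  refine ⟨T + s₀, fun t ht => ?_⟩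
  obtain ⟨a, ha, hat⟩ := hT (t - s₀) (by linarith)
  refine ⟨a + s₀, ha.trans hs₀, ?_⟩
  rwa [show a + s₀ - t = a - (t - s₀) by ring]

/-! ### Uniformly continuous solutions of non-arithmetic equations -/

/-- A solution that nearly attains its upper limit at `(i, t)` nearly attains it at all points that
are reached from `(i, t)` by a path. -/
lemma eventually_le_of_stepReach {g n : ι → ℝ → ℝ} {α : ℝ} (h : C.IsSolution g n)
    (hg : ∀ i, ∀ᶠ t in atTop, g i t = 0) (hα : ∀ η > 0, ∀ i, ∀ᶠ t in atTop, n i t ≤ α + η)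
    {i j : ι} {s : ℝ} (hs : StepReach C.P C.x i j s) {ε : ℝ} (hε : 0 < ε) :
    ∃ η > 0, ∀ᶠ t in atTop, α - η ≤ n i t → α - ε ≤ n j (t - s) := by
  classical
  induction hs generalizing ε with
  | @edge i j hP =>
    refine ⟨C.P i j * ε / 2, by positivity, ?_⟩
    set η := C.P i j * ε / 2 with hη
    have hη0 : 0 < η := by positivity
    have h1 : ∀ᶠ t in atTop, ∀ k, n k (t - C.x i k) ≤ α + η := eventually_all.2 fun k =>
      (tendsto_atTop_add_const_right _ (-C.x i k) tendsto_id).eventually (hα η hη0 k)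
    filter_upwards [h1, hg i] with t ht hgt hit
    rw [h.eq, hgt, add_zero] at hit
    have h2 : C.op n i t ≤ C.P i j * n j (t - C.x i j) + (1 - C.P i j) * (α + η) := by
      rw [op, ← Finset.add_sum_erase _ _ (Finset.mem_univ j), ← C.P_sum i,
        ← Finset.add_sum_erase Finset.univ (C.P i) (Finset.mem_univ j), add_sub_cancel_left,
        Finset.sum_mul]
      gcongr with k _
      · exact C.P_nonneg i k
      · exact ht k
    have h3 : C.P i j * (α - ε) ≤ C.P i j * n j (t - C.x i j) := by
      have : 0 < C.P i j * η := by positivity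
      nlinarith
    exact le_of_mul_le_mul_left h3 hP
  | @trans i j k s s' _ _ ih1 ih2 =>
    obtain ⟨η₂, hη₂, h2⟩ := ih2 hε
    obtain ⟨η₁, hη₁, h1⟩ := ih1 hη₂
    refine ⟨η₁, hη₁, ?_⟩
    filter_upwards [h1, (tendsto_atTop_add_const_right _ (-s) tendsto_id).eventually h2]
      with t ht1 ht2 hit
    have := ht2 (ht1 hit)
    rwa [id, show t + -s - s' = t - (s + s') by ring] at this

/-- In the non-arithmetic case, a uniformly continuous solution that nearly attains its upper limit
at a late time nearly attains it, in all states, throughout a window of prescribed length. -/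
lemma exists_window {g n : ι → ℝ → ℝ} {α : ℝ} (hC : C.NonArithmetic) (h : C.IsSolution g n)
    (hg : ∀ i, ∀ᶠ t in atTop, g i t = 0) (hn : ∀ i, UniformContinuous (n i))
    (hα : ∀ η > 0, ∀ i, ∀ᶠ t in atTop, n i t ≤ α + η) (i : ι) (X : ℝ) {ε : ℝ} (hε : 0 < ε) :
    ∃ w, ∃ η > 0, ∀ᶠ t in atTop, α - η ≤ n i t → ∀ j, ∀ s ∈ Icc w (w + X), α - ε ≤ n j (t - s) := by
  have hδ : ∃ δ > 0, ∀ j s t, |s - t| < δ → |n j s - n j t| < ε / 2 := by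
    have : ∀ j, ∀ᶠ δ in 𝓝[>] (0 : ℝ), ∀ s t, |s - t| < δ → |n j s - n j t| < ε / 2 := by
      intro j
      obtain ⟨δ, hδ, hδ'⟩ := Metric.uniformContinuous_iff.1 (hn j) (ε / 2) (half_pos hε)
      filter_upwards [Ioo_mem_nhdsGT hδ] with δ' hδ'' s t hst
      exact hδ' (hst.trans hδ''.2)
    obtain ⟨δ, h1, h2⟩ := ((eventually_all.2 this).and self_mem_nhdsWithin).exists
    exact ⟨δ, h2, h1⟩
  obtain ⟨δ, hδ0, hδ⟩ := hδ
  choose T hT using fun j => hC.exists_stepReach i j (half_pos hδ0)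
  obtain ⟨w, hw⟩ := (eventually_all.2 fun j => eventually_ge_atTop (T j)).exists
  have key : ∀ j, ∃ η > 0, ∀ᶠ t in atTop, α - η ≤ n i t →
      ∀ s ∈ Icc w (w + X), α - ε ≤ n j (t - s) := by
    intro j
    refine isCompact_Icc.induction_on (p := fun S => ∃ η > 0, ∀ᶠ t in atTop, α - η ≤ n i t →
      ∀ s ∈ S, α - ε ≤ n j (t - s)) ⟨1, one_pos, by simp⟩ ?_ ?_ fun s hs => ?_
    · rintro S S' hSS' ⟨η, hη, hS⟩
      exact ⟨η, hη, hS.mono fun t ht hit s hs => ht hit s (hSS' hs)⟩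
    · rintro S S' ⟨η, hη, hS⟩ ⟨η', hη', hS'⟩
      refine ⟨min η η', lt_min hη hη', ?_⟩
      filter_upwards [hS, hS'] with t ht ht' hit s hs
      rcases hs with hs | hs
      · exact ht (by linarith [min_le_left η η']) s hs
      · exact ht' (by linarith [min_le_right η η']) s hs
    · obtain ⟨s', hs', hss'⟩ := hT j s ((hw j).trans hs.1)
      obtain ⟨η, hη, hη'⟩ := eventually_le_of_stepReach h hg hα hs' (half_pos hε)
      refine ⟨Metric.ball s (δ / 2), mem_nhdsWithin_of_mem_nhds (Metric.ball_mem_nhds s (half_pos hδ0)),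
        η, hη, hη'.mono fun t ht hit u hu => ?_⟩
      have h1 := ht hit
      rw [Metric.mem_ball, Real.dist_eq] at hu
      have h2 := hδ j (t - u) (t - s') (by
        rw [show t - u - (t - s') = (s' - s) - (u - s) by ring]
        exact (abs_sub _ _).trans_lt (by linarith))
      have := (abs_lt.1 h2).1
      linarith
  choose η hη hη' using key
  refine ⟨w, (insert 1 (Finset.univ.image η)).min' (by simp), ?_, ?_⟩
  · rw [gt_iff_lt, Finset.lt_min'_iff]
    simp only [Finset.mem_insert, Finset.mem_image, Finset.mem_univ, true_and]
    rintro y (rfl | ⟨j, rfl⟩)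
    exacts [one_pos, hη j]
  · filter_upwards [eventually_all.2 hη'] with t ht hit j
    refine ht j (le_trans (sub_le_sub_left ?_ _) hit)
    exact Finset.min'_le _ _ (by simp)

/-- In the non-arithmetic case the flux determines the upper limit of a uniformly continuous
solution. -/
lemma eventually_le_of_nonArithmetic [Nonempty ι] {g n : ι → ℝ → ℝ} (hC : C.NonArithmetic)
    (h : C.IsSolution g n) (hg : ∀ i, ∀ᶠ t in atTop, g i t = 0)
    (hn : ∀ i, UniformContinuous (n i)) {K : ℝ} (hK : ∀ i t, |n i t| ≤ K) {L : ℝ}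
    (hL : Tendsto (C.flux n) atTop (𝓝 L)) {ε : ℝ} (hε : 0 < ε) (i : ι) :
    ∀ᶠ t in atTop, n i t ≤ L / C.mean + ε := by
  set S : Set ℝ := {b | ∀ᶠ t in atTop, ∀ i, n i t ≤ b}
  have hSne : S.Nonempty := ⟨K, Eventually.of_forall fun t i => (abs_le.1 (hK i t)).2⟩
  have hSbdd : BddBelow S := ⟨-K, fun b hb => by
    obtain ⟨t, ht⟩ := hb.exists
    exact (abs_le.1 (hK i t)).1.trans (ht i)⟩
  set α := sInf S
  have hα : ∀ η > 0, ∀ i, ∀ᶠ t in atTop, n i t ≤ α + η := fun η hη i => by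
    obtain ⟨b, hb, hbα⟩ := exists_lt_of_csInf_lt hSne (lt_add_of_pos_right α hη)
    filter_upwards [hb] with t ht
    exact (ht i).trans hbα.le
  have hα' : ∀ η > 0, ∃ᶠ t in atTop, ∃ i, α - η ≤ n i t := fun η hη => by
    have h1 : α - η ∉ S := notMem_of_lt_csInf (sub_lt_self α hη) hSbdd
    have h2 : ∃ᶠ t in atTop, ¬ ∀ i, n i t ≤ α - η := not_eventually.1 h1
    refine h2.mono fun t ht => ?_
    push Not at ht
    obtain ⟨i, hi⟩ := ht
    exact ⟨i, hi.le⟩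
  set D := ∑ i, ∑ j, C.π i * C.P i j * |C.x i j| with hD
  have hD0 : 0 ≤ D := Finset.sum_nonneg fun i _ => Finset.sum_nonneg fun j _ =>
    mul_nonneg (mul_nonneg (C.π_pos i).le (C.P_nonneg i j)) (abs_nonneg _)
  have hXb : ∃ X, ∀ i j, |C.x i j| ≤ X := ⟨∑ i, ∑ j, |C.x i j|, fun i j =>
    (Finset.single_le_sum (f := fun j => |C.x i j|) (fun _ _ => abs_nonneg _)
      (Finset.mem_univ j)).trans (Finset.single_le_sum (f := fun i => ∑ j, |C.x i j|)
        (fun _ _ => Finset.sum_nonneg fun _ _ => abs_nonneg _) (Finset.mem_univ i))⟩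
  obtain ⟨X, hX⟩ := hXb
  -- in a window where the solution is close to `α`, the flux is close to `α * C.mean`
  have hclose : ∀ δ > 0, |L - α * C.mean| ≤ δ * (D + 1) := by
    intro δ hδ
    choose w η hη hwin using fun i => exists_window hC h hg hn hα i (2 * X) hδ
    have hev : ∀ i, ∀ᶠ t in atTop,
        |C.flux n (t - (w i + X)) - L| ≤ δ ∧
          ∀ j, ∀ s ∈ Icc (w i) (w i + 2 * X), n j (t - s) ≤ α + δ := by
      intro i
      have h1 : Tendsto (fun t => t - (w i + X)) atTop atTop :=
        tendsto_atTop_add_const_right _ _ tendsto_id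
      have h2 : ∀ᶠ t in atTop, ∀ j, ∀ s ≥ t, n j s ≤ α + δ := by
        obtain ⟨T, hT⟩ := eventually_atTop.1 (eventually_all.2 (hα δ hδ))
        filter_upwards [eventually_ge_atTop T] with t ht j s hs
        exact hT s (ht.trans hs) j
      have h3 : Tendsto (fun t => t - (w i + 2 * X)) atTop atTop :=
        tendsto_atTop_add_const_right _ _ tendsto_id
      filter_upwards [(hL.comp h1).eventually (Metric.closedBall_mem_nhds L hδ),
        h3.eventually h2] with t ht ht'
      refine ⟨ht, fun j s hs => ht' j _ (by linarith [hs.2])⟩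
    obtain ⟨t, ⟨i, hit⟩, ht⟩ := ((hα' ((insert 1 (Finset.univ.image η)).min' (by simp)) (by
      rw [gt_iff_lt, Finset.lt_min'_iff]
      simp only [Finset.mem_insert, Finset.mem_image, Finset.mem_univ, true_and]
      rintro y (rfl | ⟨j, rfl⟩)
      exacts [one_pos, hη j])).and_eventually (eventually_all.2 fun i => (hwin i).and (hev i))).exists
    obtain ⟨hlow, hfl, hup⟩ := ht i
    have hlow := hlow (le_trans (sub_le_sub_left (Finset.min'_le _ _ (by simp)) _) hit)
    set τ := t - (w i + X) with hτ
    have hflux : |C.flux n τ - α * C.mean| ≤ δ * D := by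
      have e1 : C.flux n τ - α * C.mean = ∑ k, ∑ j, C.π k * C.P k j
          * ((∫ s in (τ - C.x k j)..τ, n j s) - (τ - (τ - C.x k j)) * α) := by
        simp only [flux, mean, mul_sub, Finset.sum_sub_distrib, Finset.mul_sum]
        congr 1
        refine Finset.sum_congr rfl fun k _ => ?_
        exact Finset.sum_congr rfl fun j _ => by ring
      rw [e1, hD, Finset.mul_sum]
      refine (Finset.abs_sum_le_sum_abs _ _).trans (Finset.sum_le_sum fun k _ => ?_)
      rw [Finset.mul_sum]
      refine (Finset.abs_sum_le_sum_abs _ _).trans (Finset.sum_le_sum fun j _ => ?_)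
      rw [abs_mul, abs_of_nonneg (mul_nonneg (C.π_pos k).le (C.P_nonneg k j)), mul_left_comm]
      refine mul_le_mul_of_nonneg_left ?_ (mul_nonneg (C.π_pos k).le (C.P_nonneg k j))
      have e2 := abs_integral_sub_mul_le (f := n j) (a := τ - C.x k j) (b := τ) (y := α) (ε := δ)
        ((hn j).continuous.intervalIntegrable _ _) fun s hs => by
          have e3 := abs_sub_right_of_mem_uIcc (uIoc_subset_uIcc hs)
          rw [sub_sub_cancel, abs_sub_comm] at e3
          have e4 := abs_le.1 (e3.trans (hX k j))
          have e5 : t - s ∈ Icc (w i) (w i + 2 * X) := by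
            constructor <;> linarith [e4.1, e4.2]
          have e6 := hlow j _ e5
          have e7 := hup j _ e5
          rw [sub_sub_cancel] at e6 e7
          rw [abs_le]
          constructor <;> linarith
      rwa [sub_sub_cancel] at e2 ⊢
    have e8 : L - α * C.mean = (C.flux n τ - α * C.mean) - (C.flux n τ - L) := by ring
    rw [e8]
    refine (abs_sub _ _).trans ?_
    linarith
  have hαL : α = L / C.mean := by
    have : |L - α * C.mean| ≤ 0 := by
      refine le_of_forall_pos_le_add fun δ hδ => ?_
      have := hclose (δ / (D + 1)) (by positivity)
      rwa [div_mul_cancel₀ _ (by positivity), ← zero_add δ] at this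
    rw [eq_div_iff C.mean_pos.ne']
    linarith [abs_nonpos_iff.1 this]
  rw [← hαL]
  exact hα ε hε i

/-- Renewal theorem for Lipschitz inhomogeneities of compact support. -/
theorem tendsto_of_lipschitz [Nonempty ι] {g n : ι → ℝ → ℝ} (hC : C.NonArithmetic)
    (h : C.IsSolution g n) {Λ T : ℝ} (hΛ : ∀ i s t, |g i s - g i t| ≤ Λ * |s - t|)
    (hT : ∀ i t, T < |t| → g i t = 0) (i : ι) :
    Tendsto (n i) atTop (𝓝 ((∑ i, C.π i * ∫ s, g i s) / C.mean)) := by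
  have hΛ0 : 0 ≤ Λ := by
    have := (abs_nonneg _).trans (hΛ i 1 0)
    simpa using this
  have hgc : ∀ i, Continuous (g i) := fun i =>
    (LipschitzWith.of_dist_le_mul (K := ⟨Λ, hΛ0⟩) fun s t => hΛ i s t).continuous
  have hgi : ∀ i, Integrable (g i) := fun i =>
    (hgc i).integrable_of_hasCompactSupport (HasCompactSupport.intro
      (isCompact_closedBall (0 : ℝ) T) fun t ht => hT i t (by simpa using ht))
  obtain ⟨K, hK0, hK⟩ := exists_bound_of_support (C := C) (T + 1)
  have hgb : ∀ i t, |g i t| ≤ Λ * (2 * |T| + 2) := by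
    intro i t
    rcases lt_or_ge T |t| with ht | ht
    · rw [hT i t ht, abs_zero]; positivity
    · have h1 := hΛ i t (|T| + 1)
      rw [hT i (|T| + 1) (by rw [abs_of_pos (by positivity)]; linarith [le_abs_self T]),
        sub_zero] at h1
      refine h1.trans (mul_le_mul_of_nonneg_left ((abs_sub _ _).trans ?_) hΛ0)
      rw [abs_of_pos (show 0 < |T| + 1 by positivity)]
      linarith [le_abs_self T]
  have hnb := hK g n _ (by positivity) h hgb fun i t ht => hT i t (by linarith)
  have hlip : ∀ i v, |v| ≤ 1 → ∀ t, |n i (t + v) - n i t| ≤ K * (Λ * |v|) := by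
    intro i v hv
    refine hK _ _ (Λ * |v|) (by positivity) ((h.comp_add v).sub h) (fun i t => ?_)
      (fun i t ht => ?_) i
    · have := hΛ i (t + v) t
      rwa [add_sub_cancel_left] at this
    · have h1 : |t| ≤ |t + v| + |v| := by
        have := abs_sub (t + v) v
        rwa [add_sub_cancel_right] at this
      rw [hT i t (by linarith), hT i (t + v) (by linarith), sub_zero]
  have hnu : ∀ i, UniformContinuous (n i) := by
    intro i
    rw [Metric.uniformContinuous_iff]
    intro ε hε
    refine ⟨min 1 (ε / (K * Λ + 1)), by positivity, fun {a b} hab => ?_⟩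
    rw [Real.dist_eq] at hab ⊢
    have h1 := hlip i (a - b) (hab.le.trans (min_le_left _ _)) b
    rw [add_sub_cancel] at h1
    refine h1.trans_lt ?_
    have h2 := hab.trans_le (min_le_right _ _)
    rw [lt_div_iff₀ (by positivity)] at h2
    have h3 := abs_nonneg (a - b)
    rcases h3.eq_or_lt with h3 | h3
    · rw [← h3]; simpa using hε
    · nlinarith
  have hni : ∀ i a b, IntervalIntegrable (n i) volume a b := fun i a b =>
    (hnu i).continuous.intervalIntegrable a b
  have hg0 : ∀ i, ∀ᶠ t in atTop, g i t = 0 := fun i => by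
    filter_upwards [eventually_gt_atTop T] with t ht
    exact hT i t (ht.trans_le (le_abs_self t))
  have hup := fun ε (hε : (0 : ℝ) < ε) => eventually_le_of_nonArithmetic hC h hg0 hnu hnb
    (h.tendsto_flux_atTop hgi hni) hε i
  have hdown := fun ε (hε : (0 : ℝ) < ε) => eventually_le_of_nonArithmetic hC h.neg
    (fun i => (hg0 i).mono fun t ht => by rw [ht, neg_zero]) (fun i => (hnu i).neg)
    (fun i t => by rw [abs_neg]; exact hnb i t)
    (h.neg.tendsto_flux_atTop (fun i => (hgi i).neg) fun i a b => (hni i a b).neg) hε i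
  rw [Metric.tendsto_nhds]
  intro ε hε
  filter_upwards [hup (ε / 2) (half_pos hε), hdown (ε / 2) (half_pos hε)] with t h1 h2
  simp only [integral_neg, mul_neg, Finset.sum_neg_distrib, neg_div] at h2
  rw [Real.dist_eq, abs_lt]
  constructor <;> linarith

end RenewalChain

/-! ### Step functions and Riemann sandwiches -/

lemma floor_div_eq_iff {r : ℝ} (hr : 0 < r) {t : ℝ} {k : ℤ} :
    ⌊t / r⌋ = k ↔ t ∈ Ico (k * r) ((k + 1) * r) := by
  rw [Int.floor_eq_iff, le_div_iff₀ hr, div_lt_iff₀ hr, mem_Ico]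

lemma measurable_comp_floor_div (s : ℤ → ℝ) (r : ℝ) : Measurable fun t : ℝ => s ⌊t / r⌋ :=
  (measurable_of_countable s).comp (Int.measurable_floor.comp (measurable_id.div_const r))

section StepFunction

variable {r : ℝ}

lemma iUnion_cell (hr : 0 < r) : ⋃ k : ℤ, Ico ((k : ℝ) * r) ((k + 1) * r) = univ :=
  eq_univ_of_forall fun t => mem_iUnion.2 ⟨⌊t / r⌋, (floor_div_eq_iff hr).1 rfl⟩

lemma setIntegral_cell (hr : 0 < r) (s : ℤ → ℝ) (k : ℤ) :
    ∫ t in Ico ((k : ℝ) * r) ((k + 1) * r), s ⌊t / r⌋ = r * s k := by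
  rw [setIntegral_congr_fun measurableSet_Ico
    (g := fun _ => s k) fun t ht => by simp only [(floor_div_eq_iff hr).2 ht]]
  rw [setIntegral_const, Real.volume_real_Ico_of_le (by nlinarith), smul_eq_mul]
  ring

lemma integrable_comp_floor_div (hr : 0 < r) {s : ℤ → ℝ} (hs : Summable s) :
    Integrable fun t : ℝ => s ⌊t / r⌋ := by
  rw [← integrableOn_univ, ← iUnion_cell hr]
  refine integrableOn_iUnion_of_summable_integral_norm (fun k => ?_) ?_
  · refine (integrableOn_const (C := s k) (by simp)).congr_fun (fun t ht => ?_) measurableSet_Ico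
    simp only [(floor_div_eq_iff hr).2 ht]
  · have := fun k => setIntegral_cell hr (fun k => ‖s k‖) k
    simp only [this]
    exact hs.norm.mul_left r

lemma hasSum_of_integrable_comp_floor_div (hr : 0 < r) {s : ℤ → ℝ}
    (hs : Integrable fun t : ℝ => s ⌊t / r⌋) :
    HasSum (fun k => r * s k) (∫ t, s ⌊t / r⌋) := by
  have := hasSum_integral_iUnion (f := fun t : ℝ => s ⌊t / r⌋)
    (s := fun k : ℤ => Ico ((k : ℝ) * r) ((k + 1) * r)) (μ := volume)
    (fun k => measurableSet_Ico) (fun k l hkl => ?_) hs.integrableOn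
  · simpa only [setIntegral_cell hr, iUnion_cell hr, setIntegral_univ] using this
  · refine Set.disjoint_left.2 fun t hk hl => hkl ?_
    rw [← (floor_div_eq_iff hr).2 hk, ← (floor_div_eq_iff hr).2 hl]

lemma integral_comp_floor_div (hr : 0 < r) {s : ℤ → ℝ} (hs : Summable s) :
    ∫ t, s ⌊t / r⌋ = r * ∑' k, s k := by
  rw [← tsum_mul_left]
  exact (hasSum_of_integrable_comp_floor_div hr (integrable_comp_floor_div hr hs)).tsum_eq.symm

end StepFunction

/-- `RiemannSandwich f`: on all sufficiently fine meshes, `f` lies between two integrable step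
functions whose integrals are close to each other. -/
def RiemannSandwich (f : ℝ → ℝ) : Prop :=
  ∀ ε > 0, ∀ᶠ r in 𝓝[>] (0 : ℝ), ∃ l u : ℤ → ℝ, Summable l ∧ Summable u ∧
    (∀ t, l ⌊t / r⌋ ≤ f t ∧ f t ≤ u ⌊t / r⌋) ∧ r * ∑' k, u k - r * ∑' k, l k < ε

namespace RiemannSandwich

variable {f : ℝ → ℝ}

lemma neg (hf : RiemannSandwich f) : RiemannSandwich fun t => -f t := fun ε hε => by
  filter_upwards [hf ε hε] with r ⟨l, u, hl, hu, h, hε⟩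
  refine ⟨fun k => -u k, fun k => -l k, hu.neg, hl.neg,
    fun t => ⟨neg_le_neg (h t).2, neg_le_neg (h t).1⟩, ?_⟩
  rw [tsum_neg, tsum_neg]
  linarith

lemma aestronglyMeasurable (hf : RiemannSandwich f) : AEStronglyMeasurable f := by
  have h1 : ∀ m : ℕ, ∃ r > 0, ∃ l u : ℤ → ℝ, Summable l ∧ Summable u ∧
      (∀ t, l ⌊t / r⌋ ≤ f t ∧ f t ≤ u ⌊t / r⌋) ∧
      r * ∑' k, u k - r * ∑' k, l k < 1 / ((m : ℝ) + 1) := fun m => by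
    obtain ⟨r, h, hr⟩ := ((hf (1 / ((m : ℝ) + 1)) (by positivity)).and self_mem_nhdsWithin).exists
    exact ⟨r, hr, h⟩
  choose r hr l u hl hu h hε using h1
  set lo : ℝ → ℝ := fun t => ⨆ m, l m ⌊t / r m⌋
  set up : ℝ → ℝ := fun t => ⨅ m, u m ⌊t / r m⌋
  have hlo : Measurable lo := Measurable.iSup fun m => measurable_comp_floor_div (l m) (r m)
  have hup : Measurable up := Measurable.iInf fun m => measurable_comp_floor_div (u m) (r m)
  have hlof : ∀ t, lo t ≤ f t := fun t => ciSup_le fun m => (h m t).1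
  have hfup : ∀ t, f t ≤ up t := fun t => le_ciInf fun m => (h m t).2
  have hdiff : ∀ m t, up t - lo t ≤ u m ⌊t / r m⌋ - l m ⌊t / r m⌋ := fun m t =>
    sub_le_sub (ciInf_le ⟨f t, by rintro _ ⟨m, rfl⟩; exact (h m t).2⟩ m)
      (le_ciSup (f := fun m => l m ⌊t / r m⌋) ⟨f t, by rintro _ ⟨m, rfl⟩; exact (h m t).1⟩ m)
  have hnn : ∀ t, 0 ≤ up t - lo t := fun t => sub_nonneg.2 ((hlof t).trans (hfup t))
  have hint : ∀ m, Integrable fun t => u m ⌊t / r m⌋ - l m ⌊t / r m⌋ := fun m =>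
    (integrable_comp_floor_div (hr m) (hu m)).sub (integrable_comp_floor_div (hr m) (hl m))
  have hi : Integrable fun t => up t - lo t :=
    (hint 0).mono' (hup.sub hlo).aestronglyMeasurable (Eventually.of_forall fun t => by
      rw [Real.norm_of_nonneg (hnn t)]; exact hdiff 0 t)
  have hzero : ∫ t, (up t - lo t) = 0 := by
    refine le_antisymm ?_ (integral_nonneg hnn)
    refine le_of_tendsto_of_tendsto' tendsto_const_nhds tendsto_one_div_add_atTop_nhds_zero_nat
      fun m => (integral_mono hi (hint m) (hdiff m)).trans ?_
    rw [integral_sub (integrable_comp_floor_div (hr m) (hu m))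
      (integrable_comp_floor_div (hr m) (hl m)), integral_comp_floor_div (hr m) (hu m),
      integral_comp_floor_div (hr m) (hl m)]
    exact (hε m).le
  have hae := (integral_eq_zero_iff_of_nonneg hnn hi).1 hzero
  refine hlo.aestronglyMeasurable.congr ?_
  filter_upwards [hae] with t ht
  have ht' : up t - lo t = 0 := ht
  have := hlof t
  have := hfup t
  linarith

lemma integrable (hf : RiemannSandwich f) : Integrable f := by
  obtain ⟨r, ⟨l, u, hl, hu, h, -⟩, hr⟩ := ((hf 1 one_pos).and self_mem_nhdsWithin).exists
  refine ((integrable_comp_floor_div hr hl).abs.add (integrable_comp_floor_div hr hu).abs).mono'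
    hf.aestronglyMeasurable (Eventually.of_forall fun t => ?_)
  exact abs_le_max_abs_abs (h t).1 (h t).2 |>.trans
    (max_le_add_of_nonneg (abs_nonneg _) (abs_nonneg _))

end RiemannSandwich

/-! ### Trapezoidal functions -/

/-- The trapezoidal function that is `1` on `[a, b]`, vanishes outside `(a - δ, b + δ)` and is
affine in between. -/
noncomputable def trapezoid (a b δ t : ℝ) : ℝ := max 0 (1 - max 0 (max (a - t) (t - b)) / δ)

section Trapezoid

variable {a b δ : ℝ}

lemma abs_trapezoid_sub_le (hδ : 0 < δ) (s t : ℝ) :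
    |trapezoid a b δ s - trapezoid a b δ t| ≤ δ⁻¹ * |s - t| := by
  have h1 : |max (a - s) (s - b) - max (a - t) (t - b)| ≤ |s - t| := by
    refine (abs_max_sub_max_le_max _ _ _ _).trans (max_le ?_ ?_)
    · rw [show a - s - (a - t) = -(s - t) by ring, abs_neg]
    · rw [show s - b - (t - b) = s - t by ring]
  have h2 : |max 0 (max (a - s) (s - b)) - max 0 (max (a - t) (t - b))| ≤ |s - t| := by
    refine (abs_max_sub_max_le_max _ _ _ _).trans (max_le ?_ h1)
    simp
  refine (abs_max_sub_max_le_max _ _ _ _).trans (max_le (by simp; positivity) ?_)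
  rw [sub_sub_sub_cancel_left, ← sub_div, abs_div, abs_of_pos hδ, div_eq_inv_mul, abs_sub_comm]
  gcongr

lemma trapezoid_nonneg (t : ℝ) : 0 ≤ trapezoid a b δ t := le_max_left _ _

lemma trapezoid_le_one (hδ : 0 < δ) (t : ℝ) : trapezoid a b δ t ≤ 1 :=
  max_le zero_le_one (sub_le_self _ (div_nonneg (le_max_left _ _) hδ.le))

lemma trapezoid_eq_one {t : ℝ} (ht : t ∈ Icc a b) : trapezoid a b δ t = 1 := by
  have : max (a - t) (t - b) ≤ 0 := max_le (sub_nonpos.2 ht.1) (sub_nonpos.2 ht.2)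
  simp [trapezoid, max_eq_left this]

lemma trapezoid_eq_zero (hδ : 0 < δ) {t : ℝ} (ht : t ∉ Ioo (a - δ) (b + δ)) :
    trapezoid a b δ t = 0 := by
  refine max_eq_left (sub_nonpos.2 ((one_le_div hδ).2 (le_max_of_le_right ?_)))
  rw [mem_Ioo, not_and_or, not_lt, not_lt] at ht
  rcases ht with ht | ht
  · exact le_max_of_le_left (by linarith)
  · exact le_max_of_le_right (by linarith)

lemma integral_trapezoid_mem (hδ : 0 < δ) (hab : a ≤ b) :
    ∫ t, trapezoid a b δ t ∈ Icc (b - a) (b - a + 2 * δ) := by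
  have h0 : ∀ c d : ℝ, c ≤ d → ∫ t, (Icc c d).indicator (fun _ => (1 : ℝ)) t = d - c := by
    intro c d hcd
    rw [integral_indicator measurableSet_Icc, setIntegral_const, Real.volume_real_Icc_of_le hcd]
    simp
  have hi : ∀ c d : ℝ, Integrable ((Icc c d).indicator (fun _ => (1 : ℝ))) := fun c d =>
    (integrable_indicator_iff measurableSet_Icc).2 (integrableOn_const (by simp))
  have hle : ∀ t, trapezoid a b δ t ≤ (Icc (a - δ) (b + δ)).indicator (fun _ => (1 : ℝ)) t := by
    intro t
    by_cases ht : t ∈ Icc (a - δ) (b + δ)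
    · rw [indicator_of_mem ht]; exact trapezoid_le_one hδ t
    · rw [indicator_of_notMem ht, trapezoid_eq_zero hδ fun h => ht (Ioo_subset_Icc_self h)]
  have hge : ∀ t, (Icc a b).indicator (fun _ => (1 : ℝ)) t ≤ trapezoid a b δ t := by
    intro t
    by_cases ht : t ∈ Icc a b
    · rw [indicator_of_mem ht, trapezoid_eq_one ht]
    · rw [indicator_of_notMem ht]; exact trapezoid_nonneg t
  have hc : Continuous (trapezoid a b δ) := by unfold trapezoid; fun_prop
  have hti : Integrable (trapezoid a b δ) := (hi (a - δ) (b + δ)).mono' hc.aestronglyMeasurable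
    (Eventually.of_forall fun t => by
      rw [Real.norm_of_nonneg (trapezoid_nonneg t)]; exact hle t)
  constructor
  · rw [← h0 a b hab]
    exact integral_mono (hi _ _) hti hge
  · rw [show b - a + 2 * δ = (b + δ) - (a - δ) by ring, ← h0 _ _ (by linarith)]
    exact integral_mono hti (hi _ _) hle

end Trapezoid

namespace RenewalChain

variable {ι : Type*} [Fintype ι] {C : RenewalChain ι}

lemma IsSolution.sum {κ : Type*} (s : Finset κ) {g n : κ → ι → ℝ → ℝ}
    (h : ∀ k ∈ s, C.IsSolution (g k) (n k)) :
    C.IsSolution (fun i t => ∑ k ∈ s, g k i t) (fun i t => ∑ k ∈ s, n k i t) where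
  eq i t := by
    rw [Finset.sum_congr rfl fun k hk => (h k hk).eq i t, Finset.sum_add_distrib]
    simp only [op, Finset.mul_sum]
    rw [Finset.sum_comm]
  tendsto i := by simpa using tendsto_finsetSum s fun k hk => (h k hk).tendsto i

/-! ### The key renewal theorem in the non-arithmetic case -/

lemma sum_integral_single [DecidableEq ι] (j : ι) (p : ℝ → ℝ) :
    ∑ i, C.π i * ∫ s, (Pi.single j p : ι → ℝ → ℝ) i s = C.π j * ∫ s, p s := by
  rw [Finset.sum_eq_single j (fun i _ hi => by simp [Pi.single_eq_of_ne hi]) (by simp)]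
  simp

lemma single_le_single {ι : Type*} [DecidableEq ι] {j : ι} {p q : ℝ → ℝ} (h : ∀ t, p t ≤ q t) (i : ι) (t : ℝ) :
    (Pi.single j p : ι → ℝ → ℝ) i t ≤ (Pi.single j q : ι → ℝ → ℝ) i t := by
  by_cases hi : i = j
  · subst hi; simpa using h t
  · simp [Pi.single_eq_of_ne hi]

lemma exists_isSolution_trapezoid [DecidableEq ι] [Nonempty ι] (hC : C.NonArithmetic) (j : ι) {a b δ : ℝ}
    (hδ : 0 < δ) : ∃ n, C.IsSolution (Pi.single j (trapezoid a b δ)) n ∧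
      ∀ i, Tendsto (n i) atTop (𝓝 (C.π j * (∫ t, trapezoid a b δ t) / C.mean)) := by
  have hz : ∀ t, |a| + |b| + δ < |t| → trapezoid a b δ t = 0 := fun t ht =>
    trapezoid_eq_zero hδ fun h => by
      have h1 := neg_abs_le a
      have h2 := le_abs_self b
      have h3 := abs_nonneg a
      have h4 := abs_nonneg b
      rcases abs_cases t with ⟨e, -⟩ | ⟨e, -⟩ <;> linarith [h.1, h.2]
  have hz' : ∀ i t, |a| + |b| + δ < |t| → (Pi.single j (trapezoid a b δ) : ι → ℝ → ℝ) i t = 0 :=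
    fun i t ht => by
      by_cases hi : i = j
      · subst hi; simpa using hz t ht
      · simp [Pi.single_eq_of_ne hi]
  have hb : ∀ i t, |(Pi.single j (trapezoid a b δ) : ι → ℝ → ℝ) i t| ≤ 1 := fun i t => by
    by_cases hi : i = j
    · subst hi; simpa [abs_of_nonneg (trapezoid_nonneg t)] using trapezoid_le_one hδ t
    · simp [Pi.single_eq_of_ne hi]
  obtain ⟨n, hn⟩ := exists_isSolution (C := C) hb (T := -(|a| + |b| + δ)) fun i t ht =>
    hz' i t (by have := neg_le_abs t; linarith)
  refine ⟨n, hn, fun i => ?_⟩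
  rw [← sum_integral_single]
  refine tendsto_of_lipschitz hC hn (Λ := δ⁻¹) (T := |a| + |b| + δ) (fun i s t => ?_) hz' i
  by_cases hi : i = j
  · subst hi; simpa using abs_trapezoid_sub_le hδ s t
  · simp [Pi.single_eq_of_ne hi]; positivity

/-- Blackwell's theorem: the renewal theorem for the indicator function of an interval in a single
state, by approximation with trapezoids. -/
lemma tendsto_of_cell [DecidableEq ι] [Nonempty ι] (hC : C.NonArithmetic) {r : ℝ} (hr : 0 < r) {j : ι}
    {n : ι → ℝ → ℝ}
    (h : C.IsSolution (Pi.single j fun t => if ⌊t / r⌋ = 0 then 1 else 0) n) (i : ι) :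
    Tendsto (n i) atTop (𝓝 (C.π j * r / C.mean)) := by
  have hcell : ∀ t : ℝ, ⌊t / r⌋ = 0 ↔ t ∈ Ico 0 r := fun t => by
    rw [floor_div_eq_iff hr]; simp
  rw [Metric.tendsto_nhds]
  intro ε hε
  set q := C.π j / C.mean with hq
  have hq0 : 0 < q := div_pos (C.π_pos j) C.mean_pos
  set δ := min (r / 2) (ε / (4 * q)) with hδ
  have hδ0 : 0 < δ := by positivity
  have hδr : δ ≤ r / 2 := min_le_left _ _
  have hδε : q * (2 * δ) ≤ ε / 2 := by
    have : δ ≤ ε / (4 * q) := min_le_right _ _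
    rw [le_div_iff₀ (by positivity)] at this
    linarith
  obtain ⟨nu, hnu, hnut⟩ := exists_isSolution_trapezoid hC j (a := 0) (b := r) hδ0
  obtain ⟨nl, hnl, hnlt⟩ := exists_isSolution_trapezoid hC j (a := δ) (b := r - δ) hδ0
  have hu := hnut i
  have hl := hnlt i
  have hIu := (integral_trapezoid_mem hδ0 hr.le).2
  have hIl := (integral_trapezoid_mem hδ0 (show δ ≤ r - δ by linarith)).1
  rw [mul_div_right_comm] at hu hl ⊢
  have e1 : q * (∫ t, trapezoid 0 r δ t) < q * r + ε := by nlinarith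
  have e2 : q * r - ε < q * ∫ t, trapezoid δ (r - δ) δ t := by nlinarith
  filter_upwards [hu.eventually (gt_mem_nhds e1), hl.eventually (lt_mem_nhds e2)] with t h1 h2
  have h3 := h.le hnu (single_le_single fun t => by
    split_ifs with ht
    · rw [trapezoid_eq_one (Ico_subset_Icc_self ((hcell t).1 ht))]
    · exact trapezoid_nonneg t) i t
  have h4 := hnl.le h (single_le_single fun t => by
    split_ifs with ht
    · exact trapezoid_le_one hδ0 t
    · refine (trapezoid_eq_zero hδ0 fun h => ht ((hcell t).2 ?_)).le
      exact ⟨by linarith [h.1], by linarith [h.2]⟩) i t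
  rw [Real.dist_eq, abs_lt]
  constructor <;> linarith

/-- The renewal theorem for step functions in a single state: superpose the solutions for the
individual cells, using dominated convergence. -/
lemma exists_isSolution_step [DecidableEq ι] [Nonempty ι] (hC : C.NonArithmetic) {r : ℝ} (hr : 0 < r) (j : ι)
    {u : ℤ → ℝ} (hu : Summable u) :
    ∃ n, C.IsSolution (Pi.single j fun t => u ⌊t / r⌋) n ∧
      ∀ i, Tendsto (n i) atTop (𝓝 (C.π j * (r * ∑' k, u k) / C.mean)) := by
  set p : ℝ → ℝ := fun t => if ⌊t / r⌋ = 0 then 1 else 0 with hp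
  have hcell : ∀ t : ℝ, ⌊t / r⌋ = 0 ↔ t ∈ Ico 0 r := fun t => by
    rw [floor_div_eq_iff hr]; simp
  have hb : ∀ i t, |(Pi.single j p : ι → ℝ → ℝ) i t| ≤ 1 := fun i t => by
    by_cases hi : i = j
    · subst hi; simp only [Pi.single_eq_same, hp]; split_ifs <;> simp
    · simp [Pi.single_eq_of_ne hi]
  have hz : ∀ i t, t ∉ Ico 0 r → (Pi.single j p : ι → ℝ → ℝ) i t = 0 := fun i t ht => by
    by_cases hi : i = j
    · subst hi; simp only [Pi.single_eq_same, hp, if_neg (mt (hcell t).1 ht)]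
    · simp [Pi.single_eq_of_ne hi]
  obtain ⟨R, hR⟩ := exists_isSolution (C := C) hb (T := 0)
    (fun i t ht => hz i t fun h => by linarith [h.1])
  obtain ⟨K, -, hK⟩ := exists_bound_of_support (C := C) r
  have hRK := hK _ R 1 zero_le_one hR hb fun i t ht => hz i t fun h => by
    rw [abs_of_nonneg h.1] at ht; linarith [h.2]
  rw [mul_one] at hRK
  have hsum : ∀ i t, Summable fun k : ℤ => u k * R i (t - k * r) := fun i t =>
    Summable.of_norm_bounded (g := fun k => |u k| * K) (hu.abs.mul_right K) fun k => by
      rw [norm_mul]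
      exact mul_le_mul_of_nonneg_left (hRK i _) (abs_nonneg _)
  have hlim : ∀ i {l : Filter ℝ} {y : ℝ}, (∀ k : ℤ, Tendsto (fun t => R i (t - k * r)) l (𝓝 y)) →
      Tendsto (fun t => ∑' k : ℤ, u k * R i (t - k * r)) l (𝓝 (∑' k : ℤ, u k * y)) := by
    intro i l y hy
    refine tendsto_tsum_of_dominated_convergence (bound := fun k => |u k| * K)
      (hu.abs.mul_right K) (fun k => (hy k).const_mul _) (Eventually.of_forall fun t k => ?_)
    rw [norm_mul]
    exact mul_le_mul_of_nonneg_left (hRK i _) (abs_nonneg _)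
  refine ⟨fun i t => ∑' k : ℤ, u k * R i (t - k * r), ⟨fun i t => ?_, fun i => ?_⟩, fun i => ?_⟩
  · have h1 : ∀ k : ℤ, u k * R i (t - k * r)
        = (∑ m, C.P i m * (u k * R m (t - C.x i m - k * r)))
          + u k * (Pi.single j p : ι → ℝ → ℝ) i (t - k * r) := by
      intro k
      rw [hR.eq, mul_add, op, Finset.mul_sum]
      congr 1
      refine Finset.sum_congr rfl fun m _ => ?_
      rw [sub_right_comm]; ring
    have h2 : HasSum (fun k : ℤ => ∑ m, C.P i m * (u k * R m (t - C.x i m - k * r)))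
        (C.op (fun i t => ∑' k : ℤ, u k * R i (t - k * r)) i t) :=
      hasSum_sum fun m _ => (hsum m _).hasSum.mul_left _
    have h3 : HasSum (fun k : ℤ => u k * (Pi.single j p : ι → ℝ → ℝ) i (t - k * r))
        ((Pi.single j fun t => u ⌊t / r⌋ : ι → ℝ → ℝ) i t) := by
      by_cases hi : i = j
      · subst hi
        simp only [Pi.single_eq_same, hp]
        convert hasSum_single (f := fun k : ℤ =>
          u k * (if ⌊(t - k * r) / r⌋ = 0 then (1 : ℝ) else 0)) ⌊t / r⌋ ?_ using 1
        · rw [sub_div, mul_div_cancel_right₀ _ hr.ne', Int.floor_sub_intCast]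
          simp
        · intro k hk
          rw [sub_div, mul_div_cancel_right₀ _ hr.ne', Int.floor_sub_intCast, if_neg, mul_zero]
          omega
      · simp only [Pi.single_eq_of_ne hi, Pi.zero_apply, mul_zero]
        exact hasSum_zero
    rw [tsum_congr h1]
    exact (h2.add h3).tsum_eq
  · have := hlim i (y := 0) (l := atBot) fun k =>
      (hR.tendsto i).comp (tendsto_atBot_add_const_right _ _ tendsto_id)
    simpa using this
  · have := hlim i (l := atTop) fun k => (tendsto_of_cell hC hr hR i).comp
      (tendsto_atTop_add_const_right atTop (-(k * r)) tendsto_id)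
    rw [tsum_mul_right] at this
    convert this using 2
    ring

lemma eventually_le_of_riemannSandwich [DecidableEq ι] [Nonempty ι] (hC : C.NonArithmetic) {g n : ι → ℝ → ℝ}
    (h : C.IsSolution g n) (hg : ∀ i, RiemannSandwich (g i)) {ε : ℝ} (hε : 0 < ε) (i : ι) :
    ∀ᶠ t in atTop, n i t ≤ (∑ i, C.π i * ∫ s, g i s) / C.mean + ε := by
  have hπ : 0 < ∑ j, C.π j := Finset.sum_pos (fun j _ => C.π_pos j) Finset.univ_nonempty
  set ε' := ε / 2 * C.mean / ∑ j, C.π j with hε'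
  have hε'0 : 0 < ε' := div_pos (mul_pos (half_pos hε) C.mean_pos) hπ
  obtain ⟨r, hsw, hr⟩ := ((eventually_all.2 fun j => hg j ε' hε'0).and self_mem_nhdsWithin).exists
  choose l u hl hu hlu hlt using hsw
  choose v hv hvt using fun j => exists_isSolution_step hC hr j (hu j)
  have hsum := IsSolution.sum Finset.univ fun j _ => hv j
  have hle := h.le hsum fun i t => by
    have : ∑ k, (Pi.single k (fun t => u k ⌊t / r⌋) : ι → ℝ → ℝ) i t = u i ⌊t / r⌋ := by
      rw [Finset.sum_eq_single i (fun k _ hk => by simp [Pi.single_eq_of_ne hk.symm]) (by simp)]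
      simp
    rw [this]
    exact (hlu i t).2
  have hlim : Tendsto (fun t => ∑ j, v j i t) atTop
      (𝓝 (∑ j, C.π j * (r * ∑' k, u j k) / C.mean)) :=
    tendsto_finsetSum _ fun j _ => hvt j i
  have hint : ∀ j, r * ∑' k, u j k ≤ (∫ s, g j s) + ε' := fun j => by
    have : r * ∑' k, l j k ≤ ∫ s, g j s := by
      rw [← integral_comp_floor_div hr (hl j)]
      exact integral_mono (integrable_comp_floor_div hr (hl j)) (hg j).integrable
        fun t => (hlu j t).1
    linarith [hlt j]
  have hbound : ∑ j, C.π j * (r * ∑' k, u j k) / C.mean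
      < (∑ i, C.π i * ∫ s, g i s) / C.mean + ε := by
    rw [← Finset.sum_div]
    calc _ ≤ (∑ j, C.π j * ((∫ s, g j s) + ε')) / C.mean :=
          div_le_div_of_nonneg_right (Finset.sum_le_sum fun j _ =>
            mul_le_mul_of_nonneg_left (hint j) (C.π_pos j).le) C.mean_pos.le
      _ = (∑ i, C.π i * ∫ s, g i s) / C.mean + ε / 2 := by
          have := C.mean_pos.ne'
          simp only [mul_add, Finset.sum_add_distrib, ← Finset.sum_mul]
          rw [hε']
          field_simp
      _ < _ := by linarith
  filter_upwards [hlim.eventually (gt_mem_nhds hbound)] with t ht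
  exact (hle i t).trans ht.le

/-- Renewal theorem in the non-arithmetic case. -/
theorem IsSolution.tendsto_of_nonArithmetic [Nonempty ι] (hC : C.NonArithmetic)
    {g n : ι → ℝ → ℝ} (h : C.IsSolution g n) (hg : ∀ i, RiemannSandwich (g i)) (i : ι) :
    Tendsto (n i) atTop (𝓝 ((∑ i, C.π i * ∫ s, g i s) / C.mean)) := by
  classical
  rw [Metric.tendsto_nhds]
  intro ε hε
  filter_upwards [eventually_le_of_riemannSandwich hC h hg (half_pos hε) i,
    eventually_le_of_riemannSandwich hC h.neg (fun i => (hg i).neg) (half_pos hε) i] with t h1 h2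
  simp only [integral_neg, mul_neg, Finset.sum_neg_distrib, neg_div] at h2
  rw [Real.dist_eq, abs_lt]
  constructor <;> linarith

lemma IsSolution.exists_bound {g n : ι → ℝ → ℝ} (h : C.IsSolution g n)
    (hg : ∀ i, RiemannSandwich (g i)) : ∃ K, ∀ i t, |n i t| ≤ K := by
  obtain ⟨r, hsw, hr0, hrc⟩ := ((eventually_all.2 fun j => hg j 1 one_pos).and
    (Ioo_mem_nhdsGT C.c_pos)).exists
  choose l u hl hu hlu _ using hsw
  refine ⟨_, h.abs_le_of_cell_bound hr0 hrc.le (m := fun k => ∑ i, (|l i k| + |u i k|))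
    (summable_sum fun i _ => (hl i).abs.add (hu i).abs) fun i t => ?_⟩
  refine le_trans ?_ (Finset.single_le_sum (f := fun i => |l i ⌊t / r⌋| + |u i ⌊t / r⌋|)
    (fun _ _ => by positivity) (Finset.mem_univ i))
  exact (abs_le_max_abs_abs (hlu i t).1 (hlu i t).2).trans
    (max_le_add_of_nonneg (abs_nonneg _) (abs_nonneg _))

lemma aestronglyMeasurable_iterate_op {g : ι → ℝ → ℝ} (hg : ∀ i, AEStronglyMeasurable (g i))
    (m : ℕ) (i : ι) : AEStronglyMeasurable ((C.op^[m] g) i) := by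
  induction m generalizing i with
  | zero => exact hg i
  | succ m ih =>
    rw [Function.iterate_succ_apply']
    refine Finset.aestronglyMeasurable_fun_sum _ fun j _ => ?_
    exact ((ih j).comp_quasiMeasurePreserving
      (measurePreserving_sub_right volume (C.x i j)).quasiMeasurePreserving).const_mul _

lemma aestronglyMeasurable_tsum {g : ι → ℝ → ℝ} {K s : ℝ} (hs : 0 < s)
    (hK : 0 ≤ K) (hg : ∀ i, ∀ t < 0, |g i t| ≤ K * Real.exp (s * t))
    (hgm : ∀ i, AEStronglyMeasurable (g i)) (i : ι) :
    AEStronglyMeasurable fun t => ∑' m, (C.op^[m] g) i t :=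
  aestronglyMeasurable_of_tendsto_ae atTop
    (f := fun N t => ∑ m ∈ Finset.range N, (C.op^[m] g) i t)
    (fun _ => Finset.aestronglyMeasurable_fun_sum _ fun m _ =>
      aestronglyMeasurable_iterate_op hgm m i)
    (Eventually.of_forall fun t => (summable_iterate_op hs hK hg i t).hasSum.tendsto_sum_nat)

end RenewalChain

/-! ### Direct Riemann integrability and exponential weights -/

lemma Summable.hasSum_int_add_one {s : ℤ → ℝ} (hs : Summable s) :
    HasSum (fun k => s (k + 1)) (∑' k, s k) :=
  (Equiv.hasSum_iff (f := s) (Equiv.addRight (1 : ℤ))).2 hs.hasSum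

lemma MarkovRenewal.DirectlyRiemannIntegrable.riemannSandwich {f : ℝ → ℝ}
    (hf : MarkovRenewal.DirectlyRiemannIntegrable f) : RiemannSandwich f := by
  obtain ⟨h1, L, hl, hu⟩ := hf
  intro ε hε
  have h2 : ∀ᶠ r in 𝓝[>] (0 : ℝ),
      ∑' k : ℤ, r * upperStep f r k - ∑' k : ℤ, r * lowerStep f r k < ε :=
    (hu.sub hl).eventually (gt_mem_nhds (show L - L < ε by simpa using hε))
  filter_upwards [h1, h2, self_mem_nhdsWithin] with r ⟨hb, hls, hus⟩ hlt hr
  have hr : 0 < r := hr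
  have hl' := ((summable_mul_left_iff hr.ne').1 hls).hasSum_int_add_one
  have hu' := ((summable_mul_left_iff hr.ne').1 hus).hasSum_int_add_one
  -- the mesh interval with index `k + 1` of the definition is the set where `⌊t / r⌋ = k`
  refine ⟨fun k => lowerStep f r (k + 1), fun k => upperStep f r (k + 1), hl'.summable,
    hu'.summable, fun t => ?_, ?_⟩
  · have ht : f t ∈ f '' Ico ((((⌊t / r⌋ + 1 : ℤ) : ℝ) - 1) * r) (((⌊t / r⌋ + 1 : ℤ) : ℝ) * r) := by
      refine mem_image_of_mem f ?_
      rw [Int.cast_add, Int.cast_one, add_sub_cancel_right]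
      exact (floor_div_eq_iff hr).1 rfl
    exact ⟨csInf_le (hb _).1 ht, le_csSup (hb _).2 ht⟩
  · rw [hl'.tsum_eq, hu'.tsum_eq, ← tsum_mul_left, ← tsum_mul_left]
    exact hlt

namespace RiemannSandwich

variable {f : ℝ → ℝ}

lemma const_mul (hf : RiemannSandwich f) {a : ℝ} (ha : 0 < a) :
    RiemannSandwich fun t => a * f t := fun ε hε => by
  filter_upwards [hf (ε / a) (div_pos hε ha)] with r ⟨l, u, hl, hu, h, hlt⟩
  refine ⟨fun k => a * l k, fun k => a * u k, hl.mul_left a, hu.mul_left a,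
    fun t => ⟨mul_le_mul_of_nonneg_left (h t).1 ha.le, mul_le_mul_of_nonneg_left (h t).2 ha.le⟩, ?_⟩
  rw [tsum_mul_left, tsum_mul_left]
  rw [lt_div_iff₀ ha] at hlt
  linarith

/-- The values of both step functions of a sandwich are controlled by the function itself and by
the gap of the sandwich. -/
lemma mul_tsum_abs_add_abs_le (hf : Integrable f) {r : ℝ} (hr : 0 < r) {l u : ℤ → ℝ}
    (hl : Summable l) (hu : Summable u) (h : ∀ t, l ⌊t / r⌋ ≤ f t ∧ f t ≤ u ⌊t / r⌋) :
    r * ∑' k, (|l k| + |u k|) ≤ 2 * (∫ t, |f t|) + 2 * (r * ∑' k, u k - r * ∑' k, l k) := by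
  have hd : Integrable fun t : ℝ => u ⌊t / r⌋ - l ⌊t / r⌋ :=
    (integrable_comp_floor_div hr hu).sub (integrable_comp_floor_div hr hl)
  rw [← integral_comp_floor_div hr (hl.abs.add hu.abs), ← integral_comp_floor_div hr hl,
    ← integral_comp_floor_div hr hu, ← integral_sub (integrable_comp_floor_div hr hu)
    (integrable_comp_floor_div hr hl), ← integral_const_mul, ← integral_const_mul,
    ← integral_add (hf.abs.const_mul 2) (hd.const_mul 2)]
  refine integral_mono (integrable_comp_floor_div hr (hl.abs.add hu.abs))
    ((hf.abs.const_mul 2).add (hd.const_mul 2)) fun t => ?_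
  have h1 := h t
  have h2 := abs_sub_abs_le_abs_sub (l ⌊t / r⌋) (f t)
  have h3 := abs_sub_abs_le_abs_sub (u ⌊t / r⌋) (f t)
  rw [abs_of_nonpos (sub_nonpos.2 h1.1)] at h2
  rw [abs_of_nonneg (sub_nonneg.2 h1.2)] at h3
  simp only
  linarith

/-- Far to the left, exponentially small step functions have small integral, uniformly in the
mesh. -/
lemma mul_tsum_exp_le {s r K : ℝ} (hs : 0 < s) (hr : 0 < r) (hr1 : r ≤ 1) :
    Summable (fun k : ℤ => if ((k : ℝ) + 1) * r ≤ -K then Real.exp (s * ((k + 1) * r)) else 0) ∧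
    r * ∑' k : ℤ, (if ((k : ℝ) + 1) * r ≤ -K then Real.exp (s * ((k + 1) * r)) else 0)
      ≤ Real.exp s * (Real.exp (s * -K) / s) := by
  set e : ℤ → ℝ := fun k => if ((k : ℝ) + 1) * r ≤ -K then Real.exp (s * ((k + 1) * r)) else 0
    with he
  have hmaj : ∀ t : ℝ, e ⌊t / r⌋
      ≤ (Iic (-K)).indicator (fun t => Real.exp s * Real.exp (s * t)) t := by
    intro t
    obtain ⟨h1, h2⟩ := (floor_div_eq_iff hr (t := t)).1 rfl
    simp only [he]
    split_ifs with h
    · rw [indicator_of_mem (show t ∈ Iic (-K) from h2.le.trans h), ← Real.exp_add]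
      refine Real.exp_le_exp.2 ?_
      rw [← mul_one_add]
      exact mul_le_mul_of_nonneg_left (by linarith) hs.le
    · exact indicator_nonneg (fun t _ => by positivity) t
  have he0 : ∀ k, 0 ≤ e k := fun k => by simp only [he]; split_ifs <;> positivity
  have hint : Integrable ((Iic (-K)).indicator fun t => Real.exp s * Real.exp (s * t)) :=
    (integrable_indicator_iff measurableSet_Iic).2 ((integrableOn_exp_mul_Iic hs _).const_mul _)
  have hei : Integrable fun t : ℝ => e ⌊t / r⌋ :=
    hint.mono' (measurable_comp_floor_div e r).aestronglyMeasurable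
      (Eventually.of_forall fun t => by rw [Real.norm_of_nonneg (he0 _)]; exact hmaj t)
  have hsum := hasSum_of_integrable_comp_floor_div hr hei
  refine ⟨(summable_mul_left_iff hr.ne').1 hsum.summable, ?_⟩
  rw [← tsum_mul_left, hsum.tsum_eq]
  refine (integral_mono hei hint hmaj).trans_eq ?_
  rw [integral_indicator measurableSet_Iic, integral_const_mul, integral_exp_mul_Iic hs]

/-- Multiplication with `exp (-δ t)` preserves the existence of sandwiches, provided that the
product decays exponentially at `-∞`. On `[-K, ∞)` the weight is bounded and nearly constant on the
cells of a fine mesh; on `(-∞, -K]` the product is bounded by an exponentially small function. -/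
lemma exp_mul (hf : RiemannSandwich f) {δ C s : ℝ} (hδ : 0 < δ) (hC : 0 < C) (hs : 0 < s)
    (hdecay : ∀ t < 0, Real.exp (-δ * t) * |f t| ≤ C * Real.exp (s * t)) :
    RiemannSandwich fun t => Real.exp (-δ * t) * f t := by
  intro ε hε
  obtain ⟨K, hK0, hK⟩ : ∃ K : ℝ, 0 ≤ K ∧
      2 * C * (Real.exp s * (Real.exp (s * -K) / s)) < ε / 3 := by
    have h1 : Tendsto (fun K : ℝ => s * -K) atTop atBot :=
      tendsto_neg_atTop_atBot.const_mul_atBot hs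
    have h2 := (((Real.tendsto_exp_atBot.comp h1).div_const s).const_mul (Real.exp s)).const_mul
      (2 * C)
    simp only [zero_div, mul_zero] at h2
    obtain ⟨K, h3, h4⟩ := ((h2.eventually (gt_mem_nhds (show (0 : ℝ) < ε / 3 by positivity))).and
      (eventually_ge_atTop 0)).exists
    exact ⟨K, h4, h3⟩
  set Q := Real.exp (δ * (K + 1)) with hQ
  have hQ0 : 0 < Q := Real.exp_pos _
  set I := ∫ t, |f t| with hI
  have hI0 : 0 ≤ I := integral_nonneg fun t => abs_nonneg _
  set r₀ := min 1 (ε / 3 / (2 * Q * δ * (2 * I + 2))) with hr₀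
  have hr₀0 : 0 < r₀ := by positivity
  filter_upwards [hf (min 1 (ε / (3 * Q))) (by positivity), Ioo_mem_nhdsGT hr₀0]
    with r ⟨l, u, hl, hu, h, hlt⟩ ⟨hr, hrr₀⟩
  have hr1 : r ≤ 1 := hrr₀.le.trans (min_le_left _ _)
  have hr2 : 2 * Q * δ * r * (2 * I + 2) ≤ ε / 3 := by
    have := hrr₀.le.trans (min_le_right _ _)
    rw [le_div_iff₀ (by positivity)] at this
    linarith
  obtain ⟨hes, hele⟩ := mul_tsum_exp_le (K := K) hs hr hr1
  set e : ℤ → ℝ := fun k => if ((k : ℝ) + 1) * r ≤ -K then Real.exp (s * ((k + 1) * r)) else 0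
    with he
  set q : ℤ → ℝ := fun k => Real.exp (-δ * (k * r)) with hq
  set a : ℤ → ℝ := fun k => δ * r * (|l k| + |u k|) with ha
  have ha0 : ∀ k, 0 ≤ a k := fun k => by positivity
  have hlu : ∀ k, l k ≤ u k := fun k => by
    have := h (k * r)
    rw [mul_div_cancel_right₀ _ hr.ne', Int.floor_intCast] at this
    exact this.1.trans this.2
  set lo : ℤ → ℝ := fun k => if ((k : ℝ) + 1) * r ≤ -K then -(C * e k) else q k * (l k - a k)
    with hlo
  set up : ℤ → ℝ := fun k => if ((k : ℝ) + 1) * r ≤ -K then C * e k else q k * (u k + a k)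
    with hup
  have he0 : ∀ k, 0 ≤ e k := fun k => by simp only [he]; split_ifs <;> positivity
  have hqQ : ∀ k : ℤ, ¬ ((k : ℝ) + 1) * r ≤ -K → q k ≤ Q := fun k hk => by
    refine Real.exp_le_exp.2 ?_
    rw [neg_mul_comm]
    refine mul_le_mul_of_nonneg_left ?_ hδ.le
    push Not at hk
    linarith
  have hsa : Summable a := (hl.abs.add hu.abs).mul_left (δ * r)
  have hsmaj : Summable fun k => C * e k + Q * (|l k| + |u k| + a k) :=
    (hes.mul_left C).add (((hl.abs.add hu.abs).add hsa).mul_left Q)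
  have hslo : Summable lo := Summable.of_norm_bounded hsmaj fun k => by
    have := ha0 k
    have := he0 k
    simp only [hlo]
    split_ifs with hk
    · rw [norm_neg, Real.norm_of_nonneg (by positivity)]
      have : 0 ≤ Q * (|l k| + |u k| + a k) := by positivity
      linarith
    · rw [norm_mul, Real.norm_of_nonneg (Real.exp_pos _).le]
      have h1 : ‖l k - a k‖ ≤ |l k| + |u k| + a k := (abs_sub _ _).trans (by
        rw [abs_of_nonneg (ha0 k)]; linarith [abs_nonneg (u k)])
      have h2 := mul_le_mul (hqQ k hk) h1 (norm_nonneg _) hQ0.le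
      have : 0 ≤ C * e k := by positivity
      linarith
  have hsup : Summable up := Summable.of_norm_bounded hsmaj fun k => by
    have := ha0 k
    have := he0 k
    simp only [hup]
    split_ifs with hk
    · rw [Real.norm_of_nonneg (by positivity)]
      have : 0 ≤ Q * (|l k| + |u k| + a k) := by positivity
      linarith
    · rw [norm_mul, Real.norm_of_nonneg (Real.exp_pos _).le]
      have h1 : ‖u k + a k‖ ≤ |l k| + |u k| + a k := (abs_add_le _ _).trans (by
        rw [abs_of_nonneg (ha0 k)]; linarith [abs_nonneg (l k)])
      have h2 := mul_le_mul (hqQ k hk) h1 (norm_nonneg _) hQ0.le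
      have : 0 ≤ C * e k := by positivity
      linarith
  refine ⟨lo, up, hslo, hsup, fun t => ?_, ?_⟩
  · obtain ⟨h1, h2⟩ := (floor_div_eq_iff hr (t := t)).1 rfl
    set k := ⌊t / r⌋ with hk
    by_cases hkK : ((k : ℝ) + 1) * r ≤ -K
    · simp only [hlo, hup, if_pos hkK]
      rw [← abs_le, abs_mul, abs_of_pos (Real.exp_pos _)]
      refine (hdecay t (by linarith)).trans (mul_le_mul_of_nonneg_left ?_ hC.le)
      simp only [he, if_pos hkK]
      exact Real.exp_le_exp.2 (mul_le_mul_of_nonneg_left h2.le hs.le)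
    · simp only [hlo, hup, if_neg hkK]
      have e1 : Real.exp (-δ * t) = q k * Real.exp (-δ * (t - k * r)) := by
        rw [hq, ← Real.exp_add]; ring_nf
      have e2 : Real.exp (-δ * (t - k * r)) ≤ 1 := Real.exp_le_one_iff.2 (by nlinarith)
      have e3 : 1 - δ * r ≤ Real.exp (-δ * (t - k * r)) := by
        have := Real.add_one_le_exp (-δ * (t - k * r))
        have : δ * (t - k * r) ≤ δ * r := mul_le_mul_of_nonneg_left (by linarith) hδ.le
        linarith
      have e4 : |(1 - Real.exp (-δ * (t - k * r))) * f t| ≤ a k := by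
        rw [abs_mul, abs_of_nonneg (sub_nonneg.2 e2)]
        have h3 : |f t| ≤ |l k| + |u k| := (abs_le_max_abs_abs (h t).1 (h t).2).trans
          (max_le_add_of_nonneg (abs_nonneg _) (abs_nonneg _))
        exact mul_le_mul (by linarith) h3 (abs_nonneg _) (by positivity)
      obtain ⟨e5, e6⟩ := abs_le.1 e4
      rw [e1, mul_assoc]
      have e7 := h t
      constructor
      · refine mul_le_mul_of_nonneg_left ?_ (Real.exp_pos _).le
        linarith
      · refine mul_le_mul_of_nonneg_left ?_ (Real.exp_pos _).le
        linarith
  · have hgap : ∀ k, up k - lo k ≤ 2 * C * e k + Q * (u k - l k) + 2 * Q * a k := by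
      intro k
      have h1 := hlu k
      have h2 := ha0 k
      have h3 := he0 k
      by_cases hkK : ((k : ℝ) + 1) * r ≤ -K
      · simp only [hlo, hup, if_pos hkK]
        have : 0 ≤ Q * (u k - l k) := mul_nonneg hQ0.le (by linarith)
        have : 0 ≤ Q * a k := mul_nonneg hQ0.le h2
        linarith
      · simp only [hlo, hup, if_neg hkK]
        have h4 := mul_le_mul_of_nonneg_right (hqQ k hkK) (show 0 ≤ u k - l k + 2 * a k by linarith)
        have : 0 ≤ C * e k := by positivity
        linarith
    have hs1 : Summable fun k => 2 * C * e k := hes.mul_left _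
    have hs2 : Summable fun k => Q * (u k - l k) := (hu.sub hl).mul_left _
    have hs3 : Summable fun k => 2 * Q * a k := hsa.mul_left _
    have h1 := (hsup.sub hslo).tsum_le_tsum hgap ((hs1.add hs2).add hs3)
    rw [hsup.tsum_sub hslo, (hs1.add hs2).tsum_add hs3, hs1.tsum_add hs2, tsum_mul_left,
      tsum_mul_left, tsum_mul_left, hu.tsum_sub hl, ha, tsum_mul_left] at h1
    have h2 := mul_tsum_abs_add_abs_le hf.integrable hr hl hu h
    have h3 := mul_le_mul_of_nonneg_left h1 hr.le
    have h4 : Q * (r * ∑' k, u k - r * ∑' k, l k) < ε / 3 := by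
      have := hlt.trans_le (min_le_right _ _)
      rw [lt_div_iff₀ (by positivity)] at this
      linarith
    have h5 : 2 * C * (r * ∑' k, e k) < ε / 3 :=
      (mul_le_mul_of_nonneg_left hele (by positivity)).trans_lt hK
    have h6 : 2 * Q * δ * r * (r * ∑' k, (|l k| + |u k|)) ≤ ε / 3 := by
      have h7 := hlt.trans_le (min_le_left _ _)
      exact (mul_le_mul_of_nonneg_left (by linarith) (by positivity)).trans hr2
    nlinarith

end RiemannSandwich

namespace MarkovRenewal

variable {M : ℕ} {A : Fin M → Fin M → Prop} {η ξ : Fin M → Fin M → ℝ}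

/-! ### A potential for the interarrival function -/

lemma birkhoffSum_pairFun (ζ : Fin M → Fin M → ℝ) (n : ℕ) (x : Subshift A) :
    birkhoffSum shift (pairFun A ζ) n x = ∑ k ∈ Finset.range n, ζ (x.1 k) (x.1 (k + 1)) := by
  induction n generalizing x with
  | zero => simp
  | succ n ih =>
    rw [birkhoffSum_succ', ih, Finset.sum_range_succ']
    simp [pairFun, shift, add_comm]

/-- If every letter has a successor and some Birkhoff sum of `ξ` is positive, there is a potential
`φ` such that `ξ k l + φ l - φ k` is bounded below by a positive constant on the admissible words.
It is the cheapest cost of paths starting at a letter, with respect to the cost `ξ - c`, where `c`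
is chosen so that paths cannot become arbitrarily cheap. -/
lemma exists_potential (hsucc : ∀ k, ∃ l, A k l)
    (hξ : ∃ n : ℕ, ∀ x : Subshift A, 0 < birkhoffSum shift (pairFun A ξ) n x) :
    ∃ φ : Fin M → ℝ, ∃ c > 0, ∀ k l, A k l → c ≤ ξ k l + φ l - φ k := by
  rcases isEmpty_or_nonempty (Fin M) with hM | ⟨⟨k₀⟩⟩
  · exact ⟨0, 1, one_pos, fun k => isEmptyElim k⟩
  choose succ hsucc' using hsucc
  have hstart : ∀ k, ∃ x : Subshift A, x.1 0 = k := fun k =>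
    ⟨⟨fun m => succ^[m] k, fun m => by
      simp only [Function.iterate_succ_apply', hsucc']⟩, rfl⟩
  obtain ⟨n, hn⟩ := hξ
  -- the `n`-th Birkhoff sum takes only finitely many values
  have hfin : (range fun x : Subshift A => birkhoffSum shift (pairFun A ξ) n x).Finite := by
    refine (finite_range fun y : Fin (n + 1) → Fin M =>
      ∑ k : Fin n, ξ (y k.castSucc) (y k.succ)).subset ?_
    rintro _ ⟨x, rfl⟩
    refine ⟨fun k => x.1 k, ?_⟩
    simp only [birkhoffSum_pairFun]
    rw [← Fin.sum_univ_eq_sum_range fun k => ξ (x.1 k) (x.1 (k + 1))]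
    simp
  obtain ⟨x₀, -⟩ := hstart k₀
  obtain ⟨_, ⟨x₁, rfl⟩, hmin⟩ := hfin.exists_minimal (range_nonempty_iff_nonempty.2 ⟨x₀⟩)
  have hn0 : 0 < n := Nat.pos_of_ne_zero fun h => by simpa [h] using hn x₀
  have hn0' : (0 : ℝ) < n := by exact_mod_cast hn0
  set b := birkhoffSum shift (pairFun A ξ) n x₁ with hb
  have hmin' : ∀ x, b ≤ birkhoffSum shift (pairFun A ξ) n x := fun x => by
    rcases le_total b (birkhoffSum shift (pairFun A ξ) n x) with h | h
    · exact h
    · exact hmin ⟨x, rfl⟩ h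
  set c := b / n with hc
  have hc0 : 0 < c := div_pos (hn x₁) hn0'
  set S : ℕ → Subshift A → ℝ := fun m x => birkhoffSum shift (pairFun A fun k l => ξ k l - c) m x
  have hSn : ∀ x, 0 ≤ S n x := fun x => by
    have h1 := hmin' x
    simp only [S, birkhoffSum_pairFun] at h1 ⊢
    rw [Finset.sum_sub_distrib, Finset.sum_const, Finset.card_range, nsmul_eq_mul, hc,
      mul_div_cancel₀ _ hn0'.ne']
    linarith
  have hlow : ∃ K : ℝ, ∀ m x, K ≤ S m x := by
    set B := ∑ k, ∑ l, |ξ k l - c| with hB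
    have hB0 : 0 ≤ B := Finset.sum_nonneg fun _ _ => Finset.sum_nonneg fun _ _ => abs_nonneg _
    have hBle : ∀ k l, -B ≤ ξ k l - c := fun k l => neg_le_of_abs_le
      ((Finset.single_le_sum (f := fun l => |ξ k l - c|) (fun _ _ => abs_nonneg _)
        (Finset.mem_univ l)).trans (Finset.single_le_sum (f := fun k => ∑ l, |ξ k l - c|)
        (fun _ _ => Finset.sum_nonneg fun _ _ => abs_nonneg _) (Finset.mem_univ k)))
    refine ⟨-(n * B), fun m => ?_⟩
    induction m using Nat.strong_induction_on with
    | _ m ih =>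
      intro x
      rcases lt_or_ge m n with h | h
      · have h1 : (m : ℝ) * -B ≤ S m x := by
          simp only [S, birkhoffSum_pairFun]
          rw [← nsmul_eq_mul, ← Finset.card_range m, ← Finset.sum_const, Finset.card_range]
          exact Finset.sum_le_sum fun k _ => hBle _ _
        have h2 : (m : ℝ) ≤ n := by exact_mod_cast h.le
        nlinarith
      · obtain ⟨d, rfl⟩ := Nat.exists_eq_add_of_le h
        have h1 : S (n + d) x = S n x + S d (shift^[n] x) := birkhoffSum_add _ _ _ _ _
        have h2 := ih d (by omega) (shift^[n] x)
        have h3 := hSn x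
        linarith
  obtain ⟨K, hK⟩ := hlow
  have hne : ∀ k, Nonempty {p : ℕ × Subshift A // p.2.1 0 = k} := fun k => by
    obtain ⟨x, hx⟩ := hstart k
    exact ⟨⟨(0, x), hx⟩⟩
  refine ⟨fun k => ⨅ p : {p : ℕ × Subshift A // p.2.1 0 = k}, S p.1.1 p.1.2, c, hc0,
    fun k l hkl => ?_⟩
  have hbdd : ∀ k, BddBelow (range fun p : {p : ℕ × Subshift A // p.2.1 0 = k} =>
      S p.1.1 p.1.2) := fun k => ⟨K, by rintro _ ⟨p, rfl⟩; exact hK _ _⟩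
  have hle : (⨅ p : {p : ℕ × Subshift A // p.2.1 0 = k}, S p.1.1 p.1.2) - (ξ k l - c)
      ≤ ⨅ p : {p : ℕ × Subshift A // p.2.1 0 = l}, S p.1.1 p.1.2 := by
    refine le_ciInf ?_
    rintro ⟨⟨m, x⟩, hx⟩
    -- prepend the letter `k` to the path `x`
    set y : Subshift A := ⟨fun i => Nat.casesOn i k x.1, fun i => by
      cases i with
      | zero => simp only at hx ⊢; rw [hx]; exact hkl
      | succ i => exact x.2 i⟩ with hy
    have h1 := ciInf_le (hbdd k) ⟨(m + 1, y), rfl⟩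
    have h2 : S (m + 1) y = (ξ k l - c) + S m x := by
      have h3 : shift y = x := rfl
      have h4 : y.1 1 = l := hx
      simp only [S]
      rw [birkhoffSum_succ', h3]
      simp only [pairFun, h4]
      rfl
    simp only at h1 ⊢
    linarith
  linarith

/-! ### The Markov chain behind the renewal equation -/

open Classical in
/-- The mass of the measure `F̃_ij`. -/
noncomputable def mass (A : Fin M → Fin M → Prop) (η : Fin M → Fin M → ℝ) (i j : Fin M) : ℝ :=
  if A j i then Real.exp (η j i) else 0

lemma mass_pos {i j : Fin M} (h : A j i) : 0 < mass A η i j := by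
  simp only [mass, if_pos h]; exact Real.exp_pos _

lemma mass_nonneg (i j : Fin M) : 0 ≤ mass A η i j := by
  unfold mass; split_ifs <;> positivity

lemma of_mass_ne_zero {i j : Fin M} (h : mass A η i j ≠ 0) : A j i := by
  by_contra h'
  simp [mass, h'] at h

lemma integral_kernel (F : ℝ → ℝ) (i j : Fin M) :
    ∫ u, F u ∂(kernel A η ξ i j) = mass A η i j * F (ξ j i) := by
  unfold kernel mass
  split_ifs
  · rw [integral_smul_measure, integral_dirac, ENNReal.toReal_ofReal (Real.exp_pos _).le,
      smul_eq_mul]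
  · simp

lemma massMatrix_eq_zero {i j : Fin M} (h : ¬ A j i) : massMatrix A η ξ i j = 0 := by
  simp [massMatrix, distFun, kernel, h]

lemma exists_stepReach_of_pow_pos {P x : Fin M → Fin M → ℝ} {B : Matrix (Fin M) (Fin M) ℝ}
    (hB : ∀ i j, 0 ≤ B i j) (hP : ∀ i j, 0 < B i j → 0 < P i j) {k : ℕ} (hk : 0 < k) {i j : Fin M}
    (h : 0 < (B ^ k) i j) : ∃ s, StepReach P x i j s := by
  induction k, hk using Nat.le_induction generalizing j with
  | base => exact ⟨_, .edge (hP i j (by simpa using h))⟩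
  | succ k _ ih =>
    rw [pow_succ, Matrix.mul_apply] at h
    obtain ⟨l, -, hl⟩ := Finset.exists_lt_of_sum_lt
      (show ∑ l : Fin M, (0 : ℝ) < ∑ l, (B ^ k) i l * B l j by simpa using h)
    have h1 : 0 < B l j := (hB l j).lt_of_ne fun h => by simp [← h] at hl
    obtain ⟨s, hs⟩ := ih (pos_of_mul_pos_left hl h1.le)
    exact ⟨_, hs.trans (.edge (hP l j h1))⟩

lemma exists_pos_of_stepReach {P x : Fin M → Fin M → ℝ} {i j : Fin M} {s : ℝ}
    (h : StepReach P x i j s) : ∃ k, 0 < P k j := by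
  induction h with
  | edge h => exact ⟨_, h⟩
  | trans _ _ _ ih => exact ih

/-- The kernel is primitive, some Birkhoff sum of `ξ` is strictly positive, and the transform
`B(-δ)` fixes the strictly positive row vector `ν` and the strictly positive column vector `h`. -/
structure IsCritical (A : Fin M → Fin M → Prop) (η ξ : Fin M → Fin M → ℝ) (δ : ℝ)
    (ν h : Fin M → ℝ) : Prop where
  exists_pos : ∃ n : ℕ, ∀ x : Subshift A, 0 < birkhoffSum shift (pairFun A ξ) n x
  primitive : (massMatrix A η ξ).IsPrimitive
  ν_pos : ∀ i, 0 < ν i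
  h_pos : ∀ i, 0 < h i
  left : Matrix.vecMul ν (transformMatrix A η ξ (-δ)) = ν
  right : Matrix.mulVec (transformMatrix A η ξ (-δ)) h = h

namespace IsCritical

variable {δ : ℝ} {ν h : Fin M → ℝ}

/-- The transition probabilities obtained from `B(-δ)` by conjugation with its right
eigenvector. -/
noncomputable def prob (A : Fin M → Fin M → Prop) (η ξ : Fin M → Fin M → ℝ) (δ : ℝ)
    (h : Fin M → ℝ) (i j : Fin M) : ℝ :=
  mass A η i j * Real.exp (-δ * ξ j i) * h j / h i

lemma transformMatrix_apply (i j : Fin M) :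
    transformMatrix A η ξ (-δ) i j = mass A η i j * Real.exp (-δ * ξ j i) := by
  rw [transformMatrix, Matrix.of_apply, integral_kernel fun T => Real.exp (-δ * T)]

lemma prob_pos (H : IsCritical A η ξ δ ν h) {i j : Fin M} (hA : A j i) :
    0 < prob A η ξ δ h i j :=
  div_pos (mul_pos (mul_pos (mass_pos hA) (Real.exp_pos _)) (H.h_pos j)) (H.h_pos i)

lemma of_prob_ne_zero {i j : Fin M} (hP : prob A η ξ δ h i j ≠ 0) : A j i := by
  refine of_mass_ne_zero (η := η) fun h0 => hP ?_
  simp [prob, h0]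

lemma exists_stepReach (H : IsCritical A η ξ δ ν h) (hM : 0 < M) (i j : Fin M) :
    ∃ s, StepReach (prob A η ξ δ h) (fun i j => ξ j i) i j s := by
  have : Nonempty (Fin M) := ⟨⟨0, hM⟩⟩
  have h1 := H.primitive.1
  obtain ⟨k, hk, hpos⟩ := (Matrix.isIrreducible_iff_exists_pow_pos h1).1
    H.primitive.isIrreducible i j
  refine exists_stepReach_of_pow_pos h1 (fun i j hij => H.prob_pos ?_) hk hpos
  by_contra hA
  exact hij.ne' (massMatrix_eq_zero hA)

lemma exists_drift (H : IsCritical A η ξ δ ν h) :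
    ∃ φ : Fin M → ℝ, ∃ c > 0, ∀ k l, A k l → c ≤ ξ k l + φ l - φ k := by
  refine exists_potential (fun k => ?_) H.exists_pos
  obtain ⟨s, hs⟩ := H.exists_stepReach (Nat.zero_lt_of_lt k.2) k k
  obtain ⟨i, hi⟩ := exists_pos_of_stepReach hs
  exact ⟨i, of_prob_ne_zero hi.ne'⟩

/-- The Markov chain with transition probabilities `prob`, stationary vector `ν i * h i` and steps
`ξ j i`. -/
noncomputable def chain (H : IsCritical A η ξ δ ν h) : RenewalChain (Fin M) where
  P := prob A η ξ δ h
  x i j := ξ j i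
  φ := H.exists_drift.choose
  c := H.exists_drift.choose_spec.choose
  π i := ν i * h i
  c_pos := H.exists_drift.choose_spec.choose_spec.1
  P_nonneg i j := div_nonneg (mul_nonneg (mul_nonneg (mass_nonneg i j) (Real.exp_pos _).le)
    (H.h_pos j).le) (H.h_pos i).le
  P_sum i := by
    have h1 := congrFun H.right i
    simp only [Matrix.mulVec, dotProduct, transformMatrix_apply] at h1
    simp only [prob, ← Finset.sum_div, h1, div_self (H.h_pos i).ne']
  drift i j hP := H.exists_drift.choose_spec.choose_spec.2 j i (of_prob_ne_zero hP)
  π_pos i := mul_pos (H.ν_pos i) (H.h_pos i)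
  stationary j := by
    have h1 := congrFun H.left j
    simp only [Matrix.vecMul, dotProduct, transformMatrix_apply] at h1
    conv_rhs => rw [← h1, Finset.sum_mul]
    refine Finset.sum_congr rfl fun i _ => ?_
    have := (H.h_pos i).ne'
    simp only [prob]
    field_simp
  irreducible i j := H.exists_stepReach (Nat.zero_lt_of_lt i.2) i j

/-- If the loop lengths at a state generate a discrete group, then the lengths of paths from that
state to all others define a transfer function that makes `ξ` lattice. -/
lemma nonArithmetic (H : IsCritical A η ξ δ ν h) (hξ : ¬ IsLattice (pairFun A ξ)) :
    H.chain.NonArithmetic := by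
  intro i₀
  refine (AddSubgroup.dense_or_cyclic _).resolve_right fun ⟨a, ha⟩ => hξ ?_
  rw [← AddSubgroup.zmultiples_eq_closure] at ha
  have hloop : ∀ s, StepReach H.chain.P H.chain.x i₀ i₀ s → s ∈ AddSubgroup.zmultiples a :=
    fun s hs => ha ▸ AddSubgroup.subset_closure hs
  choose ψ hψ using fun j => H.chain.irreducible i₀ j
  choose χ hχ using fun j => H.chain.irreducible j i₀
  have hcont : ∀ F : Fin M → Fin M → ℝ, Continuous fun x : Subshift A => F (x.1 0) (x.1 1) :=
    fun F => by
      have h1 : Continuous fun p : Fin M × Fin M => F p.1 p.2 := continuous_of_discreteTopology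
      have h2 : ∀ k, Continuous fun x : Subshift A => x.1 k := fun k =>
        (continuous_apply k).comp continuous_subtype_val
      exact h1.comp ((h2 0).prodMk (h2 1))
  refine ⟨fun x => ξ (x.1 0) (x.1 1) + ψ (x.1 1) - ψ (x.1 0), fun x => ψ (x.1 0),
    hcont fun k l => ξ k l + ψ l - ψ k, hcont fun k _ => ψ k, fun x => ?_,
    AddSubgroup.zmultiples a, inferInstance, fun x => ?_⟩
  · simp only [pairFun, shift]; ring
  · have hedge : StepReach H.chain.P H.chain.x (x.1 1) (x.1 0) (ξ (x.1 0) (x.1 1)) :=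
      .edge (H.prob_pos (x.2 0))
    -- close the two paths from `i₀` to `x.1 0` by the same return path
    have h1 := hloop _ (((hψ (x.1 1)).trans hedge).trans (hχ (x.1 0)))
    have h2 := hloop _ ((hψ (x.1 0)).trans (hχ (x.1 0)))
    have h3 := sub_mem h1 h2
    convert h3 using 1
    ring

/-! ### Passing to the normalised equation -/

/-- The normalised function `e^{-δt} N(t, i) / h_i`. -/
noncomputable def normalize (δ : ℝ) (h : Fin M → ℝ) (N : Fin M → ℝ → ℝ) : Fin M → ℝ → ℝ :=
  fun i t => Real.exp (-δ * t) * N i t / h i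

lemma mul_normalize (H : IsCritical A η ξ δ ν h) (N : Fin M → ℝ → ℝ) (i : Fin M) (t : ℝ) :
    h i * normalize δ h N i t = Real.exp (-δ * t) * N i t := by
  rw [normalize, mul_div_cancel₀ _ (H.h_pos i).ne']

lemma eq_mul_normalize (H : IsCritical A η ξ δ ν h) (N : Fin M → ℝ → ℝ) (i : Fin M) (t : ℝ) :
    N i t = Real.exp (δ * t) * h i * normalize δ h N i t := by
  rw [mul_assoc, H.mul_normalize, ← mul_assoc, ← Real.exp_add]
  simp

lemma renewalOp_apply (g : Fin M → ℝ → ℝ) (i : Fin M) (t : ℝ) :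
    renewalOp A η ξ g i t = ∑ j, mass A η i j * g j (t - ξ j i) := by
  simp only [renewalOp, integral_kernel fun u => g _ (t - u)]

lemma normalize_renewalOp (H : IsCritical A η ξ δ ν h) (g : Fin M → ℝ → ℝ) :
    normalize δ h (renewalOp A η ξ g) = H.chain.op (normalize δ h g) := by
  ext i t
  rw [normalize, renewalOp_apply, RenewalChain.op, Finset.mul_sum, Finset.sum_div]
  refine Finset.sum_congr rfl fun j _ => ?_
  simp only [chain, prob, normalize]
  have h1 := (H.h_pos i).ne'
  have h2 := (H.h_pos j).ne'
  have h3 : Real.exp (-δ * t) = Real.exp (-δ * ξ j i) * Real.exp (-δ * (t - ξ j i)) := by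
    rw [← Real.exp_add]; ring_nf
  rw [h3]
  field_simp

lemma normalize_iterate (H : IsCritical A η ξ δ ν h) (g : Fin M → ℝ → ℝ) (m : ℕ) :
    normalize δ h ((renewalOp A η ξ)^[m] g) = H.chain.op^[m] (normalize δ h g) := by
  induction m with
  | zero => rfl
  | succ m ih => rw [Function.iterate_succ_apply', Function.iterate_succ_apply',
      H.normalize_renewalOp, ih]

lemma normalize_renewalFunction (H : IsCritical A η ξ δ ν h) (f : Fin M → ℝ → ℝ) :
    normalize δ h (renewalFunction A η ξ f)
      = fun i t => ∑' m, (H.chain.op^[m] (normalize δ h f)) i t := by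
  ext i t
  rw [normalize, renewalFunction, ← tsum_mul_left, ← tsum_div_const]
  exact tsum_congr fun m => by rw [← H.normalize_iterate]; rfl

lemma isSolution_normalize_iff (H : IsCritical A η ξ δ ν h) {f N : Fin M → ℝ → ℝ} :
    H.chain.IsSolution (normalize δ h f) (normalize δ h N) ↔ SolvesRenewalEq A η ξ f N ∧
      ∀ i, Tendsto (fun t : ℝ => Real.exp (-δ * t) * N i t) atBot (𝓝 0) := by
  have h1 : ∀ i t, (normalize δ h N i t
      = H.chain.op (normalize δ h N) i t + normalize δ h f i t) ↔
        N i t = renewalOp A η ξ N i t + f i t := fun i t => by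
    rw [← H.normalize_renewalOp]
    simp only [normalize]
    rw [← add_div, div_left_inj' (H.h_pos i).ne', ← mul_add,
      mul_right_inj' (Real.exp_pos _).ne']
  have h2 : ∀ i, Tendsto (normalize δ h N i) atBot (𝓝 0) ↔
      Tendsto (fun t : ℝ => Real.exp (-δ * t) * N i t) atBot (𝓝 0) := fun i => by
    constructor
    · intro h'
      simpa only [H.mul_normalize, mul_zero] using h'.const_mul (h i)
    · intro h'
      have h3 := h'.div_const (h i)
      rwa [zero_div] at h3
  exact ⟨fun hs => ⟨fun i t => (h1 i t).1 (hs.eq i t), fun i => (h2 i).1 (hs.tendsto i)⟩,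
    fun hs => ⟨fun i t => (h1 i t).2 (hs.1 i t), fun i => (h2 i).2 (hs.2 i)⟩⟩

lemma meanStep_eq (H : IsCritical A η ξ δ ν h) : meanStep A η ξ δ ν h = H.chain.mean := by
  simp only [meanStep, RenewalChain.mean, integral_kernel fun T => T * Real.exp (-δ * T)]
  refine Finset.sum_congr rfl fun k _ => Finset.sum_congr rfl fun j _ => ?_
  have := (H.h_pos k).ne'
  simp only [chain, prob]
  field_simp

lemma renewalLimit_eq (H : IsCritical A η ξ δ ν h) (f : Fin M → ℝ → ℝ) (i : Fin M) :
    renewalLimit A η ξ δ ν h f i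
      = h i * ((∑ j, H.chain.π j * ∫ s, normalize δ h f j s) / H.chain.mean) := by
  rw [renewalLimit, H.meanStep_eq, mul_div_assoc]
  congr 2
  refine Finset.sum_congr rfl fun j _ => ?_
  simp only [normalize, integral_div, chain]
  have := (H.h_pos j).ne'
  field_simp

lemma exists_decay (H : IsCritical A η ξ δ ν h) {f : Fin M → ℝ → ℝ} {C s : ℝ} (hC : 0 < C)
    (hdecay : ∀ t < 0, ∀ i, Real.exp (-δ * t) * |f i t| ≤ C * Real.exp (s * t)) :
    ∃ K, 0 ≤ K ∧ ∀ i, ∀ t < 0, |normalize δ h f i t| ≤ K * Real.exp (s * t) := by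
  refine ⟨∑ i, C / h i, Finset.sum_nonneg fun i _ => (div_pos hC (H.h_pos i)).le,
    fun i t ht => ?_⟩
  have h1 : |normalize δ h f i t| ≤ C / h i * Real.exp (s * t) := by
    rw [normalize, abs_div, abs_mul, abs_of_pos (Real.exp_pos _), abs_of_pos (H.h_pos i),
      div_mul_eq_mul_div]
    exact div_le_div_of_nonneg_right (hdecay t ht i) (H.h_pos i).le
  refine h1.trans (mul_le_mul_of_nonneg_right ?_ (Real.exp_pos _).le)
  exact Finset.single_le_sum (f := fun i => C / h i) (fun i _ => (div_pos hC (H.h_pos i)).le)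
    (Finset.mem_univ i)

end IsCritical

end MarkovRenewal

theorem mainTheorem5 (M : ℕ) (hM : 2 ≤ M)
    (A : Fin M → Fin M → Prop) (η ξ : Fin M → Fin M → ℝ)
    -- some Birkhoff sum of the interarrival function is strictly positive on the subshift
    (hξ : ∃ n : ℕ, ∀ x : MarkovRenewal.Subshift A,
      0 < birkhoffSum MarkovRenewal.shift (MarkovRenewal.pairFun A ξ) n x)
    (hF : (MarkovRenewal.massMatrix A η ξ).IsPrimitive)
    (δ : ℝ) (hδ : 0 < δ)
    (hspec : spectralRadius ℂ
      ((MarkovRenewal.transformMatrix A η ξ (-δ)).map (fun r : ℝ => (r : ℂ))) = 1)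
    (ν h : Fin M → ℝ) (hν_pos : ∀ i, 0 < ν i) (hh_pos : ∀ i, 0 < h i)
    (hν : Matrix.vecMul ν (MarkovRenewal.transformMatrix A η ξ (-δ)) = ν)
    (hh : Matrix.mulVec (MarkovRenewal.transformMatrix A η ξ (-δ)) h = h)
    (f : Fin M → ℝ → ℝ)
    (hf : ∀ i, MarkovRenewal.DirectlyRiemannIntegrable (f i))
    (hdecay : ∃ C s : ℝ, 0 < C ∧ 0 < s ∧
      ∀ t < 0, ∀ i, Real.exp (-δ * t) * |f i t| ≤ C * Real.exp (s * t)) :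
    -- the quantities that define the limit make sense
    (∀ j, Integrable (fun T : ℝ => Real.exp (-δ * T) * f j T)) ∧
    0 < MarkovRenewal.meanStep A η ξ δ ν h ∧
    -- the renewal series converges absolutely, and the renewal function is a solution of the
    -- renewal equation that is negligible at `-∞`
    (∀ i t, Summable fun n : ℕ =>
      ((MarkovRenewal.renewalOp A η ξ)^[n] (fun j u => |f j u|)) i t) ∧
    MarkovRenewal.SolvesRenewalEq A η ξ f (MarkovRenewal.renewalFunction A η ξ f) ∧
    (∀ i, Tendsto (fun t : ℝ => Real.exp (-δ * t) * MarkovRenewal.renewalFunction A η ξ f i t)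
      atBot (𝓝 0)) ∧
    -- asymptotics of every solution of that kind
    ∀ N : Fin M → ℝ → ℝ, MarkovRenewal.SolvesRenewalEq A η ξ f N →
      (∀ i, Tendsto (fun t : ℝ => Real.exp (-δ * t) * N i t) atBot (𝓝 0)) →
      (¬ MarkovRenewal.IsLattice (MarkovRenewal.pairFun A ξ) →
        ∀ i, Tendsto (fun t : ℝ => Real.exp (-δ * t) * N i t) atTop
          (𝓝 (MarkovRenewal.renewalLimit A η ξ δ ν h f i))) ∧
      (∀ i,
        (∀ t : ℝ, IntervalIntegrable (fun T : ℝ => Real.exp (-δ * T) * N i T) volume 0 t) ∧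
        Tendsto (fun t : ℝ => t⁻¹ * ∫ T in (0 : ℝ)..t, Real.exp (-δ * T) * N i T) atTop
          (𝓝 (MarkovRenewal.renewalLimit A η ξ δ ν h f i))) := by
  have H : MarkovRenewal.IsCritical A η ξ δ ν h := ⟨hξ, hF, hν_pos, hh_pos, hν, hh⟩
  have : Nonempty (Fin M) := ⟨⟨0, by omega⟩⟩
  obtain ⟨C, s, hC, hs, hdec⟩ := hdecay
  have hsand : ∀ i, RiemannSandwich fun t => Real.exp (-δ * t) * f i t := fun i =>
    (hf i).riemannSandwich.exp_mul hδ hC hs fun t ht => hdec t ht i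
  set g := MarkovRenewal.IsCritical.normalize δ h f with hg
  have hgsand : ∀ i, RiemannSandwich (g i) := fun i => by
    have h1 : g i = fun t => (h i)⁻¹ * (Real.exp (-δ * t) * f i t) :=
      funext fun t => div_eq_inv_mul _ _
    rw [h1]
    exact (hsand i).const_mul (inv_pos.2 (hh_pos i))
  obtain ⟨K, hK, hgdec⟩ := H.exists_decay hC hdec
  have hsol := RenewalChain.isSolution_tsum (C := H.chain) hs hK hgdec
  have hren := hsol
  rw [← H.normalize_renewalFunction] at hren
  obtain ⟨hren1, hren2⟩ := H.isSolution_normalize_iff.1 hren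
  refine ⟨fun i => (hsand i).integrable, by rw [H.meanStep_eq]; exact H.chain.mean_pos,
    fun i t => ?_, hren1, hren2, fun N hN hN0 => ?_⟩
  · obtain ⟨K', hK', hdec'⟩ := H.exists_decay (f := fun j u => |f j u|) hC
      (by simpa only [abs_abs] using hdec)
    have h1 := (RenewalChain.summable_iterate_op (C := H.chain) hs hK' hdec' i t).mul_left
      (Real.exp (δ * t) * h i)
    refine h1.congr fun m => ?_
    rw [H.eq_mul_normalize ((MarkovRenewal.renewalOp A η ξ)^[m] _), H.normalize_iterate]
  · have hNs := H.isSolution_normalize_iff.2 ⟨hN, hN0⟩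
    have hNm : ∀ i, AEStronglyMeasurable (MarkovRenewal.IsCritical.normalize δ h N i) := by
      rw [hNs.unique hsol]
      exact RenewalChain.aestronglyMeasurable_tsum hs hK hgdec fun i =>
        (hgsand i).aestronglyMeasurable
    obtain ⟨B, hB⟩ := hNs.exists_bound hgsand
    refine ⟨fun hlat i => ?_, fun i => ⟨fun t => ?_, ?_⟩⟩
    · rw [H.renewalLimit_eq]
      refine ((hNs.tendsto_of_nonArithmetic (H.nonArithmetic hlat) hgsand i).const_mul (h i)).congr
        fun t => H.mul_normalize N i t
    · refine ((RenewalChain.intervalIntegrable_of_abs_le (hNm i) (hB i) 0 t).const_mul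
        (h i)).congr fun T _ => H.mul_normalize N i T
    · rw [H.renewalLimit_eq]
      refine ((hNs.tendsto_average (fun i => (hgsand i).integrable) hB hNm i).const_mul
        (h i)).congr fun t => ?_
      simp only [← H.mul_normalize N i]
      rw [intervalIntegral.integral_const_mul]
      ring
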